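/- Let $\mathcal H$ be a complex Hilbert space of dimension at least $2$ (possibly infinite), $\mathbb B(\mathcal H)$ the bounded operators with the operator order ($X\le Y$ iff $Y-X$ is positive), $\mathbb B(\mathcal H)^+$ the positive operators, and $\mathbb P$ the positive invertible operators. Write $A_k\nearrow A$ (resp. $A_k\searrow A$) if $(A_k)$ is an increasing (resp. decreasing) sequence converging to $A$ in the strong operator topology. An *operator mean* is a map $\sigma:\mathbb B(\mathcal H)^+\times\mathbb B(\mathcal H)^+\to\mathbb B(\mathcal H)^+$ with: (i) $A\le C,\ B\le D\Rightarrow A\,\sigma\,B\le C\,\sigma\,D$; (ii) $C(A\,\sigma\,B)C\le (CAC)\,\sigma\,(CBC)$ for $C\in\mathbb B(\mathcal H)^+$; (iii) $A_k\searrow A,\ B_k\searrow B\Rightarrow A_k\,\sigma\,B_k\searrow A\,\sigma\,B$; (iv) $I\,\sigma\,I=I$. An *$n$-variable operator mean* is a map $\mathfrak M:\mathbb P^n\to\mathbb P$ with: (I) $A_j\le B_j$ for all $j$ implies $\mathfrak M(A_1,\dots,A_n)\le\mathfrak M(B_1,\dots,B_n)$; (II) $S^*\mathfrak M(A_1,\dots,A_n)S=\mathfrak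 M(S^*A_1S,\dots,S^*A_nS)$ for invertible $S\in\mathbb B(\mathcal H)$; (III) if $A_j,A_{jk}\in\mathbb P$ and either $A_{jk}\nearrow A_j$ as $k\to\infty$ for every $j$, or $A_{jk}\searrow A_j$ as $k\to\infty$ for every $j$, then $\mathfrak M(A_{1k},\dots,A_{nk})\to\mathfrak M(A_1,\dots,A_n)$ strongly; (IV) $\mathfrak M(I,\dots,I)=I$. Let $\omega=(\omega_1,\dots,\omega_n)$ be a probability vector ($\omega_j\ge0$, $\sum_j\omega_j=1$), and let $\mathfrak M$ be an $n$-variable operator mean such that $$\Big(\sum_j\omega_jB_j^{-1}\Big)^{-1}\le\mathfrak M(B_1,\dots,B_n)\le\sum_j\omega_jB_j\qquad(B_1,\dots,B_n\in\mathbb P).$$ Let $\sigma$ be an operator mean different from the left trivial mean $A\,\ell\,B=A$. Then for all $B_1,\dots,B_n\in\mathbb P$ the equation $X=\mathfrak M(X\,\sigma\,B_1,\dots,X\,\sigma\,B_n)$ has a unique solution $X\in\mathbb P$; it is called the deformed mean and is denoted by $\mathfrak M_\sigma(B_1,\dots,B_n)$. For $h>0$, $h\ne1$ and $r\ne0,1$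 let $$K(h,r)=\frac{h^r-h}{(r-1)(h-1)}\left(\frac{r-1}{r}\cdot\frac{h^r-1}{h^r-h}\right)^{r}$$ be the generalized Kantorovich constant, and let $$S(h)=\frac{(h-1)h^{1/(h-1)}}{e\log h}\quad(h\neq1),\qquad S(1)=1,$$ be the Specht ratio. Let $A_1,\dots,A_n\in\mathbb P$ satisfy $mI\le A_j\le MI$ for all $j$, with scalars $0<m<M$, and put $h=M/m$. Then the following hold. 1. If $1\le q\le p$, then $$K(h^p,-\tfrac qp)^{-1/q}\,\mathfrak M_\sigma(A_1^p,\dots,A_n^p)^{1/p}\le\mathfrak M_\sigma(A_1^q,\dots,A_n^q)^{1/q}\le K(h^p,-\tfrac qp)^{1/q}\,\mathfrak M_\sigma(A_1^p,\dots,A_n^p)^{1/p}.$$ 2. If $0<q<1$ and $q<p$, then $$K(h^q,\tfrac1q)^{-1}K(h^p,-\tfrac qp)^{-1/q}\,\mathfrak M_\sigma(A_1^p,\dots,A_n^p)^{1/p}\le\mathfrak M_\sigma(A_1^q,\dots,A_n^q)^{1/q}\le K(h^q,\tfrac1q)K(h^p,-\tfrac qp)^{1/q}\,\mathfrak M_\sigma(A_1^p,\dots,A_n^p)^{1/p}.$$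 3. For all $p>0$, $$S(h)^{-1}S(h^p)^{-1/p}\,\mathfrak M_\sigma(A_1^p,\dots,A_n^p)^{1/p}\le\exp\Big(\sum_{j=1}^n\omega_j\log A_j\Big)\le S(h)S(h^p)^{1/p}\,\mathfrak M_\sigma(A_1^p,\dots,A_n^p)^{1/p}.$$ -/

import Mathlib

open Filter Topology

noncomputable section

/-- `A_k ↘ A`: the sequence is decreasing in the operator order and converges to `A` in the
strong operator topology. -/
def DecreasesTo {H : Type*} [NormedAddCommGroup H] [InnerProductSpace ℂ H] [CompleteSpace H]
    (A : ℕ → H →L[ℂ] H) (L : H →L[ℂ] H) : Prop :=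
  Antitone A ∧ ∀ x : H, Tendsto (fun k => A k x) atTop (𝓝 (L x))

/-- `A_k ↗ A`: the sequence is increasing in the operator order and converges to `A` in the
strong operator topology. -/
def IncreasesTo {H : Type*} [NormedAddCommGroup H] [InnerProductSpace ℂ H] [CompleteSpace H]
    (A : ℕ → H →L[ℂ] H) (L : H →L[ℂ] H) : Prop :=
  Monotone A ∧ ∀ x : H, Tendsto (fun k => A k x) atTop (𝓝 (L x))

/-- A two-variable operator mean in the sense of Kubo and Ando: a binary operation on the cone of
positive operators (its values off the cone are irrelevant). -/
structure IsOperatorMean {H : Type*} [NormedAddCommGroup H] [InnerProductSpace ℂ H]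
    [CompleteSpace H] (σ : (H →L[ℂ] H) → (H →L[ℂ] H) → (H →L[ℂ] H)) : Prop where
  nonneg : ∀ A B : H →L[ℂ] H, 0 ≤ A → 0 ≤ B → 0 ≤ σ A B
  monotone : ∀ A B C D : H →L[ℂ] H, 0 ≤ A → 0 ≤ B → A ≤ C → B ≤ D → σ A B ≤ σ C D
  transformer : ∀ A B C : H →L[ℂ] H, 0 ≤ A → 0 ≤ B → 0 ≤ C →
    C * σ A B * C ≤ σ (C * A * C) (C * B * C)
  downward_continuous : ∀ (A B : ℕ → H →L[ℂ] H) (A' B' : H →L[ℂ] H),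
    (∀ k, 0 ≤ A k) → (∀ k, 0 ≤ B k) → 0 ≤ A' → 0 ≤ B' →
    DecreasesTo A A' → DecreasesTo B B' → DecreasesTo (fun k => σ (A k) (B k)) (σ A' B')
  normalized : σ 1 1 = 1

/-- `σ` is the left trivial mean `A σ B = A`. -/
def IsLeftTrivialMean {H : Type*} [NormedAddCommGroup H] [InnerProductSpace ℂ H]
    [CompleteSpace H] (σ : (H →L[ℂ] H) → (H →L[ℂ] H) → (H →L[ℂ] H)) : Prop :=
  ∀ A B : H →L[ℂ] H, 0 ≤ A → 0 ≤ B → σ A B = A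

/-- An `n`-variable operator mean: a map on `n`-tuples of positive invertible operators (its
values on other tuples are irrelevant). -/
structure IsMultiOperatorMean {H : Type*} [NormedAddCommGroup H] [InnerProductSpace ℂ H]
    [CompleteSpace H] {n : ℕ} (𝔐 : (Fin n → H →L[ℂ] H) → (H →L[ℂ] H)) : Prop where
  strictlyPositive : ∀ A : Fin n → H →L[ℂ] H, (∀ j, IsStrictlyPositive (A j)) →
    IsStrictlyPositive (𝔐 A)
  monotone : ∀ A B : Fin n → H →L[ℂ] H, (∀ j, IsStrictlyPositive (A j)) →
    (∀ j, IsStrictlyPositive (B j)) → (∀ j, A j ≤ B j) → 𝔐 A ≤ 𝔐 B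
  congruence : ∀ (A : Fin n → H →L[ℂ] H) (S : H →L[ℂ] H), (∀ j, IsStrictlyPositive (A j)) →
    IsUnit S → star S * 𝔐 A * S = 𝔐 (fun j => star S * A j * S)
  monotone_continuous : ∀ (A : ℕ → Fin n → H →L[ℂ] H) (A' : Fin n → H →L[ℂ] H),
    (∀ k j, IsStrictlyPositive (A k j)) → (∀ j, IsStrictlyPositive (A' j)) →
    ((∀ j, IncreasesTo (fun k => A k j) (A' j)) ∨ (∀ j, DecreasesTo (fun k => A k j) (A' j))) →
    ∀ x : H, Tendsto (fun k => 𝔐 (A k) x) atTop (𝓝 (𝔐 A' x))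
  normalized : 𝔐 (fun _ => 1) = 1

/-- The weighted arithmetic mean. -/
def arithMean {H : Type*} [NormedAddCommGroup H] [InnerProductSpace ℂ H] [CompleteSpace H]
    {n : ℕ} (ω : Fin n → ℝ) (A : Fin n → H →L[ℂ] H) : H →L[ℂ] H :=
  ∑ j, ω j • A j

/-- The weighted harmonic mean. -/
def harmMean {H : Type*} [NormedAddCommGroup H] [InnerProductSpace ℂ H] [CompleteSpace H]
    {n : ℕ} (ω : Fin n → ℝ) (A : Fin n → H →L[ℂ] H) : H →L[ℂ] H :=
  Ring.inverse (∑ j, ω j • Ring.inverse (A j))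

/-- `X` is a positive invertible solution of `X = 𝔐(X σ A₁, …, X σ Aₙ)`. -/
def SolvesDeformedEq {H : Type*} [NormedAddCommGroup H] [InnerProductSpace ℂ H] [CompleteSpace H]
    {n : ℕ} (𝔐 : (Fin n → H →L[ℂ] H) → (H →L[ℂ] H))
    (σ : (H →L[ℂ] H) → (H →L[ℂ] H) → (H →L[ℂ] H)) (A : Fin n → H →L[ℂ] H)
    (X : H →L[ℂ] H) : Prop :=
  IsStrictlyPositive X ∧ X = 𝔐 (fun j => σ X (A j))

open Classical in
/-- The deformed mean `𝔐_σ(A₁, …, Aₙ)`: the unique positive invertible solution `X` of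
`X = 𝔐(X σ A₁, …, X σ Aₙ)` (and `0` if there is no unique solution). -/
def deformedMean {H : Type*} [NormedAddCommGroup H] [InnerProductSpace ℂ H] [CompleteSpace H]
    {n : ℕ} (𝔐 : (Fin n → H →L[ℂ] H) → (H →L[ℂ] H))
    (σ : (H →L[ℂ] H) → (H →L[ℂ] H) → (H →L[ℂ] H)) (A : Fin n → H →L[ℂ] H) : H →L[ℂ] H :=
  if hX : ∃! X : H →L[ℂ] H, SolvesDeformedEq 𝔐 σ A X then hX.choose else 0

/-- The generalized Kantorovich constant `K(h, r)` (for `h > 0`, `h ≠ 1` and `r ≠ 0, 1`). -/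
def kantorovich (h r : ℝ) : ℝ :=
  (h ^ r - h) / ((r - 1) * (h - 1)) * ((r - 1) / r * ((h ^ r - 1) / (h ^ r - h))) ^ r

open Classical in
/-- The Specht ratio `S(h)`. -/
def specht (h : ℝ) : ℝ :=
  if h = 1 then 1 else (h - 1) * h ^ (1 / (h - 1)) / (Real.exp 1 * Real.log h)

end

/-! All three estimates rest on one sandwich: X_p = 𝔐_σ(A_1^p, …, A_n^p) lies between the weighted
harmonic and arithmetic means of the A_j^p (`deformedMean_rpow_mem_Icc`). After that 𝔐 and σ play no
role, and the argument is a reverse Jensen inequality of Mond–Pečarić type: a convex function lies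
below its chord on an interval, affine functions pass through weighted averages, and the chord is at
most K (or S) times the function everywhere. For log the constant becomes an additive log S. Thus ∑
ω_j A_j^q ≤ K (∑ ω_j A_j^(-p))^(-q/p) ≤ K X_p^(q/p), the last step by Löwner–Heinz since q ≤ p; the
opposite bound comes in the same way after an inversion. Raising to the power 1/q preserves order if
q ≥ 1 and costs Furuta's factor K(h^q, 1/q) if q < 1. For the log-Euclidean mean one compares
logarithms, and exponentiating costs S(h).

For the sandwich, σ A B ≤ (1 - α) A + α B for some α > 0, and likewise for inverses; inserted in X =
𝔐(X σ B_j), the term (1 - α) X cancels. Existence and uniqueness of X hold because X ↦ 𝔐(X σ B_j)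
strictly contracts a Thompson-type distance on order intervals.

Both properties of σ are obtained without an integral representation. The map B ↦ 1 σ B respects
projections commuting with B, so on scalars it is a function g, and two such maps are ordered as
soon as their symbols are (`IsLocalMonotone.le_of_symbol_le`). Rank-one projections in a
two-dimensional subspace show that g is concave and, unless constant, strictly increasing; a
constant g means the left trivial mean. A supporting line of g at 1 gives α, and a positive lower
bound for the slopes of g on compact intervals gives the contraction. -/

set_option linter.unusedSectionVars false

/-! ### Affine bounds for powers, exponential and logarithm -/

theorem one_add_mul_sub_one_le_rpow {r x : ℝ} (hr : r < 0 ∨ 1 < r) (hx : 0 < x) :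
    1 + r * (x - 1) ≤ x ^ r := by
  rcases hr with hr | hr
  · rw [Real.rpow_def_of_pos hx]
    nlinarith [Real.add_one_le_exp (Real.log x * r), Real.log_le_sub_one_of_pos hx]
  · simpa using one_add_mul_self_le_rpow_one_add (s := x - 1) (by linarith) hr.le

theorem rpow_add_mul_sub_le_rpow {r t y : ℝ} (hr : r < 0 ∨ 1 < r) (ht : 0 < t) (hy : 0 < y) :
    t ^ r + r * t ^ r / t * (y - t) ≤ y ^ r := by
  have h := one_add_mul_sub_one_le_rpow hr (div_pos hy ht)
  rw [Real.div_rpow hy.le ht.le, le_div_iff₀ (Real.rpow_pos_of_pos ht r)] at h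
  calc _ = (1 + r * (y / t - 1)) * t ^ r := by field_simp
    _ ≤ _ := h

/-- Average the two tangent inequalities at the endpoints with weights b - t and t - a: the slope s
drops out. -/
theorem le_chord_of_tangent {f : ℝ → ℝ} {s a b t : ℝ} (hab : a < b) (ht : t ∈ Set.Icc a b)
    (ha : f t + s * (a - t) ≤ f a) (hb : f t + s * (b - t) ≤ f b) :
    f t ≤ (f b - f a) / (b - a) * t + (f a - (f b - f a) / (b - a) * a) := by
  have hba : 0 < b - a := sub_pos.2 hab
  have key : f t * (b - a) ≤ (f b - f a) * t + (f a * (b - a) - (f b - f a) * a) := by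
    nlinarith [mul_le_mul_of_nonneg_left ha (sub_nonneg.2 ht.2),
      mul_le_mul_of_nonneg_left hb (sub_nonneg.2 ht.1)]
  rw [← mul_le_mul_iff_left₀ hba]
  calc _ ≤ _ := key
    _ = _ := by field_simp

/-- The affine function is the chord over [1, h]. With u the base of the r-th power in the
Kantorovich constant and c its prefactor, the chord equals c (1 + r (u t - 1)), while the bound
equals c (u t)^r, so Bernoulli at u t suffices. The sign of the slope matters only for Furuta's
inequality, where r > 1. -/
theorem exists_affine_between_rpow_one {r h : ℝ} (hr : r < 0 ∨ 1 < r) (hh : 1 < h) :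
    ∃ α β : ℝ, (∀ t ∈ Set.Icc 1 h, t ^ r ≤ α * t + β) ∧
      (∀ t, 0 < t → α * t + β ≤ kantorovich h r * t ^ r) ∧ (1 < r → 0 ≤ α) := by
  have h0 : 0 < h := by linarith
  have hh1 : 0 < h - 1 := by linarith
  refine ⟨(h ^ r - 1) / (h - 1), 1 - (h ^ r - 1) / (h - 1), fun t ht => ?_, fun t ht => ?_,
    fun hr1 => div_nonneg (sub_nonneg.2 (Real.one_le_rpow hh.le (by linarith))) hh1.le⟩
  · have ht0 : 0 < t := by linarith [ht.1]
    have := le_chord_of_tangent (f := fun t => t ^ r) hh ht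
      (rpow_add_mul_sub_le_rpow hr ht0 one_pos) (rpow_add_mul_sub_le_rpow hr ht0 h0)
    simpa using this
  · set u := (r - 1) / r * ((h ^ r - 1) / (h ^ r - h)) with hu
    have hr0 : r ≠ 0 := by rcases hr with hr | hr <;> linarith
    have hr1 : r - 1 ≠ 0 := by rcases hr with hr | hr <;> intro H <;> linarith
    have signs : (h ^ r - h ≠ 0) ∧ 0 < u ∧ 0 < (h ^ r - h) / ((r - 1) * (h - 1)) := by
      rcases hr with hr | hr
      · have h1 : h ^ r < 1 := Real.rpow_lt_one_of_one_lt_of_neg hh hr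
        have h2 : h ^ r - h < 0 := by linarith
        exact ⟨h2.ne, mul_pos (div_pos_of_neg_of_neg (by linarith) hr)
          (div_pos_of_neg_of_neg (by linarith) h2),
          div_pos_of_neg_of_neg h2 (mul_neg_of_neg_of_pos (by linarith) hh1)⟩
      · have h1 : h < h ^ r := by
          simpa using Real.rpow_lt_rpow_of_exponent_lt hh hr
        have h2 : 0 < h ^ r - h := by linarith
        exact ⟨h2.ne', mul_pos (div_pos (by linarith) (by linarith)) (div_pos (by linarith) h2),
          div_pos h2 (mul_pos (by linarith) hh1)⟩
    obtain ⟨h2, hu0, hc⟩ := signs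
    have hK : kantorovich h r * t ^ r
        = (h ^ r - h) / ((r - 1) * (h - 1)) * (u * t) ^ r := by
      rw [Real.mul_rpow hu0.le ht.le, kantorovich, ← hu]; ring
    rw [hK]
    refine le_trans (le_of_eq ?_)
      (mul_le_mul_of_nonneg_left (one_add_mul_sub_one_le_rpow hr (mul_pos hu0 ht)) hc.le)
    rw [hu]
    generalize h ^ r = k at *
    field_simp
    ring

/-- Between `t ^ r` and `K(M/m, r) t ^ r` there is an affine function: the chord over `[m, M]`
dominates the power on `[m, M]` and is at most `K(M/m, r) t ^ r` on the whole half-line. -/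
theorem exists_affine_between_rpow {r m M : ℝ} (hr : r < 0 ∨ 1 < r) (hm : 0 < m) (hmM : m < M) :
    ∃ α β : ℝ, (∀ t ∈ Set.Icc m M, t ^ r ≤ α * t + β) ∧
      (∀ t, 0 < t → α * t + β ≤ kantorovich (M / m) r * t ^ r) ∧ (1 < r → 0 ≤ α) := by
  obtain ⟨α, β, h1, h2, h3⟩ := exists_affine_between_rpow_one hr ((one_lt_div hm).2 hmM)
  have hmr := Real.rpow_pos_of_pos hm r
  have e : ∀ t, m ^ r * α / m * t + m ^ r * β = m ^ r * (α * (t / m) + β) := fun t => by ring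
  refine ⟨m ^ r * α / m, m ^ r * β, fun t ht => ?_, fun t ht => ?_, fun h => ?_⟩
  · have ht0 : 0 < t := hm.trans_le ht.1
    have := h1 (t / m) ⟨(one_le_div hm).2 ht.1, (div_le_div_iff_of_pos_right hm).2 ht.2⟩
    rw [Real.div_rpow ht0.le hm.le, div_le_iff₀ hmr] at this
    rw [e]; linarith
  · have := h2 (t / m) (div_pos ht hm)
    rw [Real.div_rpow ht.le hm.le, ← mul_div_assoc (kantorovich (M / m) r), le_div_iff₀ hmr] at this
    rw [e]; linarith
  · have := h3 h
    positivity

theorem one_le_kantorovich {r h : ℝ} (hr : r < 0 ∨ 1 < r) (hh : 1 < h) : 1 ≤ kantorovich h r := by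
  obtain ⟨α, β, h1, h2, -⟩ := exists_affine_between_rpow_one hr hh
  simpa using (h1 1 ⟨le_rfl, hh.le⟩).trans (h2 1 one_pos)

/-- With k = (h - 1) / log h one has S(h) = k exp(1/k - 1), so the claim is k (x + 1) ≤ k exp x at x
= 1/k - 1 + u. -/
theorem one_add_mul_le_specht_mul_exp {h : ℝ} (hh : 1 < h) (u : ℝ) :
    1 + (h - 1) / Real.log h * u ≤ specht h * Real.exp u := by
  have hL : 0 < Real.log h := Real.log_pos hh
  have hh1 : 0 < h - 1 := by linarith
  have hS : specht h = (h - 1) / Real.log h * Real.exp (Real.log h / (h - 1) - 1) := by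
    rw [specht, if_neg hh.ne', Real.rpow_def_of_pos (by linarith), Real.exp_sub, mul_one_div]
    field_simp
  rw [hS, mul_assoc, ← Real.exp_add]
  calc 1 + (h - 1) / Real.log h * u
      = (h - 1) / Real.log h * (Real.log h / (h - 1) - 1 + u + 1) := by field_simp; ring
    _ ≤ _ := mul_le_mul_of_nonneg_left (Real.add_one_le_exp _) (by positivity)

theorem one_le_specht {h : ℝ} (hh : 1 < h) : 1 ≤ specht h := by
  simpa using one_add_mul_le_specht_mul_exp hh 0

theorem exists_affine_between_exp {m M : ℝ} (hm : 0 < m) (hmM : m < M) :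
    ∃ α β : ℝ, 0 ≤ α ∧
      (∀ t ∈ Set.Icc (Real.log m) (Real.log M), Real.exp t ≤ α * t + β) ∧
      (∀ t, α * t + β ≤ specht (M / m) * Real.exp t) := by
  have hM : 0 < M := hm.trans hmM
  have hh : 1 < M / m := (one_lt_div hm).2 hmM
  have hl : Real.log m < Real.log M := Real.log_lt_log hm hmM
  have tang : ∀ t y, Real.exp t + Real.exp t * (y - t) ≤ Real.exp y := fun t y => by
    have := mul_le_mul_of_nonneg_left (Real.add_one_le_exp (y - t)) (Real.exp_pos t).le
    rw [← Real.exp_add, add_sub_cancel] at this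
    linarith
  refine ⟨_, _, ?_, fun t ht => le_chord_of_tangent hl ht (tang _ _) (tang _ _), fun t => ?_⟩
  · rw [Real.exp_log hM, Real.exp_log hm]
    exact div_nonneg (by linarith) (by linarith)
  · have h1 := mul_le_mul_of_nonneg_left
      (one_add_mul_le_specht_mul_exp hh (t - Real.log m)) hm.le
    rw [Real.exp_sub, Real.exp_log hm, Real.log_div hM.ne' hm.ne'] at h1
    rw [Real.exp_log hM, Real.exp_log hm]
    have hl' : Real.log M - Real.log m ≠ 0 := by linarith
    calc _ = m * (1 + (M / m - 1) / (Real.log M - Real.log m) * (t - Real.log m)) := by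
          field_simp; ring
      _ ≤ _ := h1
      _ = _ := by field_simp

theorem exists_affine_between_log {m M : ℝ} (hm : 0 < m) (hmM : m < M) :
    ∃ α β : ℝ, (∀ t ∈ Set.Icc m M, α * t + β ≤ Real.log t) ∧
      (∀ t, 0 < t → Real.log t ≤ α * t + β + Real.log (specht (M / m))) := by
  have hM : 0 < M := hm.trans hmM
  have hh : 1 < M / m := (one_lt_div hm).2 hmM
  have hL : 0 < Real.log (M / m) := Real.log_pos hh
  have hl : 0 < M / m - 1 := by linarith
  have hMm : 0 < M - m := by linarith
  refine ⟨Real.log (M / m) / (M - m), Real.log m - Real.log (M / m) / (M - m) * m,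
    fun t ht => ?_, fun t ht => ?_⟩
  · have ht0 : 0 < t := hm.trans_le ht.1
    have tang : ∀ y, 0 < y → -Real.log t + -(1 / t) * (y - t) ≤ -Real.log y := fun y hy => by
      have := Real.log_le_sub_one_of_pos (div_pos hy ht0)
      rw [Real.log_div hy.ne' ht0.ne'] at this
      have e : -(1 / t) * (y - t) = -(y / t - 1) := by field_simp
      rw [e]; linarith
    have := le_chord_of_tangent (f := fun t => -Real.log t) hmM ht (tang m hm) (tang M hM)
    rw [Real.log_div hM.ne' hm.ne']
    have e : (-Real.log M - -Real.log m) / (M - m) = -((Real.log M - Real.log m) / (M - m)) := by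
      ring
    simp only [e] at this
    linarith
  · have hS : 0 < specht (M / m) := one_pos.trans_le (one_le_specht hh)
    -- This argument turns the affine side into t / m; taking logarithms turns the factor S into the
    -- summand log S.
    have h1 := one_add_mul_le_specht_mul_exp hh (Real.log (M / m) / (M / m - 1) * (t / m - 1))
    have e : 1 + (M / m - 1) / Real.log (M / m) *
        (Real.log (M / m) / (M / m - 1) * (t / m - 1)) = t / m := by
      field_simp; ring
    rw [e] at h1
    have h2 := Real.log_le_log (div_pos ht hm) h1
    rw [Real.log_mul hS.ne' (Real.exp_ne_zero _), Real.log_exp, Real.log_div ht.ne' hm.ne'] at h2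
    have e2 : Real.log (M / m) / (M / m - 1) * (t / m - 1)
        = Real.log (M / m) / (M - m) * t - Real.log (M / m) / (M - m) * m := by
      field_simp
    linarith

/-! ### Functional calculus bounds and reverse Jensen inequalities in C⋆-algebras -/

section CStar

variable {A : Type*} [CStarAlgebra A] [PartialOrder A] [StarOrderedRing A]

theorem isSelfAdjoint_of_smul_one_le {a : A} {m : ℝ} (h : m • (1 : A) ≤ a) : IsSelfAdjoint a := by
  have h1 : IsSelfAdjoint (a - m • (1 : A)) := .of_nonneg (sub_nonneg.2 h)
  have h2 : IsSelfAdjoint (m • (1 : A)) := (IsSelfAdjoint.all m).smul (.one A)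
  simpa using h1.add h2

theorem isStrictlyPositive_of_smul_one_le {a : A} {m : ℝ} (hm : 0 < m) (h : m • (1 : A) ≤ a) :
    IsStrictlyPositive a :=
  (IsStrictlyPositive.smul hm isStrictlyPositive_one).of_le h

theorem mem_Icc_of_mem_spectrum {a : A} {m M : ℝ} (hm : m • (1 : A) ≤ a) (hM : a ≤ M • (1 : A))
    {x : ℝ} (hx : x ∈ spectrum ℝ a) : x ∈ Set.Icc m M := by
  have ha := isSelfAdjoint_of_smul_one_le hm
  rw [← Algebra.algebraMap_eq_smul_one] at hm hM
  exact ⟨(algebraMap_le_iff_le_spectrum ha).1 hm x hx, (le_algebraMap_iff_spectrum_le ha).1 hM x hx⟩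

theorem exists_smul_one_le {a : A} (ha : IsStrictlyPositive a) :
    ∃ k : ℝ, 0 < k ∧ k • (1 : A) ≤ a := by
  rcases subsingleton_or_nontrivial A with hA | hA
  · exact ⟨1, one_pos, (Subsingleton.elim _ _).le⟩
  obtain ⟨k, hk, h⟩ := (CFC.exists_pos_algebraMap_le_iff ha.isSelfAdjoint).2
    fun x hx => ha.spectrum_pos hx
  exact ⟨k, hk, by rwa [← Algebra.algebraMap_eq_smul_one]⟩

theorem le_norm_smul_one {a : A} (ha : IsSelfAdjoint a) : a ≤ ‖a‖ • (1 : A) := by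
  rw [← Algebra.algebraMap_eq_smul_one]
  exact ha.le_algebraMap_norm_self

theorem smul_one_le_smul_one {a b : ℝ} (h : a ≤ b) : a • (1 : A) ≤ b • (1 : A) :=
  smul_le_smul_of_nonneg_right h zero_le_one

theorem cfc_affine {a : A} (ha : IsSelfAdjoint a) (α β : ℝ) :
    cfc (fun t : ℝ => α * t + β) a = α • a + β • (1 : A) := by
  rw [cfc_add_const .., cfc_const_mul_id .., Algebra.algebraMap_eq_smul_one]

theorem cfc_le_affine {a : A} (ha : IsSelfAdjoint a) {f : ℝ → ℝ} {α β : ℝ}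
    (hf : ContinuousOn f (spectrum ℝ a)) (h : ∀ t ∈ spectrum ℝ a, f t ≤ α * t + β) :
    cfc f a ≤ α • a + β • (1 : A) := by
  rw [← cfc_affine ha]
  exact cfc_mono h

theorem affine_le_cfc {a : A} (ha : IsSelfAdjoint a) {f : ℝ → ℝ} {α β : ℝ}
    (hf : ContinuousOn f (spectrum ℝ a)) (h : ∀ t ∈ spectrum ℝ a, α * t + β ≤ f t) :
    α • a + β • (1 : A) ≤ cfc f a := by
  rw [← cfc_affine ha]
  exact cfc_mono h

theorem continuousOn_rpow_spectrum {a : A} (ha : IsStrictlyPositive a) (r : ℝ) :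
    ContinuousOn (fun t : ℝ => t ^ r) (spectrum ℝ a) := fun t ht =>
  (Real.continuousAt_rpow_const t r (Or.inl (ha.spectrum_pos ht).ne')).continuousWithinAt

theorem smul_one_le_rpow {a : A} {m p : ℝ} (hm : 0 < m) (hp : 0 ≤ p)
    (h : m • (1 : A) ≤ a) : m ^ p • (1 : A) ≤ a ^ p := by
  have ha := isStrictlyPositive_of_smul_one_le hm h
  rw [CFC.rpow_eq_cfc_real (ha := ha.nonneg), ← Algebra.algebraMap_eq_smul_one]
  rw [← Algebra.algebraMap_eq_smul_one, algebraMap_le_iff_le_spectrum ha.isSelfAdjoint] at h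
  exact algebraMap_le_cfc _ _ _ (fun x hx => Real.rpow_le_rpow hm.le (h x hx) hp)
    (continuousOn_rpow_spectrum ha p) ha.isSelfAdjoint

theorem rpow_le_smul_one {a : A} {M p : ℝ} (hp : 0 ≤ p) (ha : IsStrictlyPositive a)
    (h : a ≤ M • (1 : A)) : a ^ p ≤ M ^ p • (1 : A) := by
  rw [CFC.rpow_eq_cfc_real (ha := ha.nonneg), ← Algebra.algebraMap_eq_smul_one]
  rw [← Algebra.algebraMap_eq_smul_one, le_algebraMap_iff_spectrum_le ha.isSelfAdjoint] at h
  exact cfc_le_algebraMap _ _ _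
    (fun x hx => Real.rpow_le_rpow (ha.spectrum_pos hx).le (h x hx) hp)
    (continuousOn_rpow_spectrum ha p) ha.isSelfAdjoint

theorem rpow_le_smul_one_of_nonpos {a : A} {m p : ℝ} (hm : 0 < m) (hp : p ≤ 0)
    (h : m • (1 : A) ≤ a) : a ^ p ≤ m ^ p • (1 : A) := by
  have ha := isStrictlyPositive_of_smul_one_le hm h
  rw [CFC.rpow_eq_cfc_real (ha := ha.nonneg), ← Algebra.algebraMap_eq_smul_one]
  rw [← Algebra.algebraMap_eq_smul_one, algebraMap_le_iff_le_spectrum ha.isSelfAdjoint] at h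
  exact cfc_le_algebraMap _ _ _ (fun x hx => Real.rpow_le_rpow_of_nonpos hm (h x hx) hp)
    (continuousOn_rpow_spectrum ha p) ha.isSelfAdjoint

theorem smul_one_le_rpow_of_nonpos {a : A} {M p : ℝ} (hp : p ≤ 0) (ha : IsStrictlyPositive a)
    (h : a ≤ M • (1 : A)) : M ^ p • (1 : A) ≤ a ^ p := by
  rw [CFC.rpow_eq_cfc_real (ha := ha.nonneg), ← Algebra.algebraMap_eq_smul_one]
  rw [← Algebra.algebraMap_eq_smul_one, le_algebraMap_iff_spectrum_le ha.isSelfAdjoint] at h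
  exact algebraMap_le_cfc _ _ _
    (fun x hx => Real.rpow_le_rpow_of_nonpos (ha.spectrum_pos hx) (h x hx) hp)
    (continuousOn_rpow_spectrum ha p) ha.isSelfAdjoint

theorem smul_rpow {a : A} {c : ℝ} (hc : 0 < c) (ha : IsStrictlyPositive a) (s : ℝ) :
    (c • a) ^ s = c ^ s • a ^ s := by
  have hsa := ha.isSelfAdjoint
  rw [← cfc_const_mul_id c a, CFC.cfc_rpow (fun x hx => mul_pos hc (ha.spectrum_pos hx)),
    CFC.rpow_eq_cfc_real (ha := ha.nonneg),
    ← cfc_smul _ _ _ (continuousOn_rpow_spectrum ha s)]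
  exact cfc_congr fun x hx => by
    simp [Real.mul_rpow hc.le (ha.spectrum_pos hx).le]

section Sum

variable {ι : Type*} [Fintype ι] {ω : ι → ℝ}

theorem smul_one_le_sum (hω : ∀ j, 0 ≤ ω j) (hω1 : ∑ j, ω j = 1) {C : ι → A} {m : ℝ}
    (h : ∀ j, m • (1 : A) ≤ C j) : m • (1 : A) ≤ ∑ j, ω j • C j := by
  calc m • (1 : A) = ∑ j, ω j • (m • (1 : A)) := by rw [← Finset.sum_smul, hω1, one_smul]
    _ ≤ _ := Finset.sum_le_sum fun j _ => smul_le_smul_of_nonneg_left (h j) (hω j)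

theorem sum_le_smul_one (hω : ∀ j, 0 ≤ ω j) (hω1 : ∑ j, ω j = 1) {C : ι → A} {M : ℝ}
    (h : ∀ j, C j ≤ M • (1 : A)) : ∑ j, ω j • C j ≤ M • (1 : A) := by
  calc _ ≤ ∑ j, ω j • (M • (1 : A)) :=
        Finset.sum_le_sum fun j _ => smul_le_smul_of_nonneg_left (h j) (hω j)
    _ = _ := by rw [← Finset.sum_smul, hω1, one_smul]

theorem sum_smul_affine (hω1 : ∑ j, ω j = 1) (C : ι → A) (α β : ℝ) :
    ∑ j, ω j • (α • C j + β • (1 : A)) = α • ∑ j, ω j • C j + β • (1 : A) := by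
  simp_rw [smul_add, Finset.sum_add_distrib, ← Finset.sum_smul, hω1, one_smul, Finset.smul_sum,
    smul_comm α]

/-- The reverse Jensen inequality for negative powers. -/
theorem sum_rpow_le_kantorovich_smul (hω : ∀ j, 0 ≤ ω j) (hω1 : ∑ j, ω j = 1) {C : ι → A}
    {m M r : ℝ} (hr : r < 0) (hm : 0 < m) (hmM : m < M) (h1 : ∀ j, m • (1 : A) ≤ C j)
    (h2 : ∀ j, C j ≤ M • (1 : A)) :
    ∑ j, ω j • C j ^ r ≤ kantorovich (M / m) r • (∑ j, ω j • C j) ^ r := by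
  obtain ⟨α, β, hα, hβ, -⟩ := exists_affine_between_rpow (Or.inl hr) hm hmM
  have hC := fun j => isStrictlyPositive_of_smul_one_le hm (h1 j)
  have hS := isStrictlyPositive_of_smul_one_le hm (smul_one_le_sum hω hω1 h1)
  calc _ ≤ ∑ j, ω j • (α • C j + β • (1 : A)) := by
        refine Finset.sum_le_sum fun j _ => smul_le_smul_of_nonneg_left ?_ (hω j)
        rw [CFC.rpow_eq_cfc_real (ha := (hC j).nonneg)]
        exact cfc_le_affine (hC j).isSelfAdjoint (continuousOn_rpow_spectrum (hC j) r)
          fun t ht => hα t (mem_Icc_of_mem_spectrum (h1 j) (h2 j) ht)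
    _ = α • ∑ j, ω j • C j + β • (1 : A) := sum_smul_affine hω1 C α β
    _ ≤ cfc (fun t : ℝ => kantorovich (M / m) r * t ^ r) (∑ j, ω j • C j) :=
        affine_le_cfc hS.isSelfAdjoint
          (continuousOn_const.mul (continuousOn_rpow_spectrum hS r))
          fun t ht => hβ t (hS.spectrum_pos ht)
    _ = _ := by
        rw [cfc_const_mul _ _ _ (continuousOn_rpow_spectrum hS r),
          CFC.rpow_eq_cfc_real (ha := hS.nonneg)]

/-- The reverse Jensen inequality for the logarithm. -/
theorem log_sum_le (hω : ∀ j, 0 ≤ ω j) (hω1 : ∑ j, ω j = 1) {C : ι → A}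
    {m M : ℝ} (hm : 0 < m) (hmM : m < M) (h1 : ∀ j, m • (1 : A) ≤ C j)
    (h2 : ∀ j, C j ≤ M • (1 : A)) :
    CFC.log (∑ j, ω j • C j)
      ≤ ∑ j, ω j • CFC.log (C j) + Real.log (specht (M / m)) • (1 : A) := by
  obtain ⟨α, β, hα, hβ⟩ := exists_affine_between_log hm hmM
  have hC := fun j => isStrictlyPositive_of_smul_one_le hm (h1 j)
  have hS := isStrictlyPositive_of_smul_one_le hm (smul_one_le_sum hω hω1 h1)
  have hlog : ∀ {a : A}, IsStrictlyPositive a → ContinuousOn Real.log (spectrum ℝ a) :=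
    fun ha => Real.continuousOn_log.mono fun t ht => (ha.spectrum_pos ht).ne'
  calc CFC.log (∑ j, ω j • C j)
      ≤ α • ∑ j, ω j • C j + (β + Real.log (specht (M / m))) • (1 : A) :=
        cfc_le_affine hS.isSelfAdjoint (hlog hS) fun t ht => by
          have := hβ t (hS.spectrum_pos ht)
          linarith
    _ = ∑ j, ω j • (α • C j + β • (1 : A)) + Real.log (specht (M / m)) • (1 : A) := by
        rw [sum_smul_affine hω1, add_smul, add_assoc]
    _ ≤ _ := by
        gcongr with j
        · exact hω j
        · exact affine_le_cfc (hC j).isSelfAdjoint (hlog (hC j))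
            fun t ht => hα t (mem_Icc_of_mem_spectrum (h1 j) (h2 j) ht)

end Sum

/-- Furuta's order-preserving inequality for powers greater than one. -/
theorem rpow_le_kantorovich_smul_rpow {a b : A} {m M s : ℝ} (hs : 1 < s) (hm : 0 < m)
    (hmM : m < M) (h1 : m • (1 : A) ≤ a) (h2 : a ≤ M • (1 : A)) (hab : a ≤ b) :
    a ^ s ≤ kantorovich (M / m) s • b ^ s := by
  obtain ⟨α, β, hα, hβ, h0⟩ := exists_affine_between_rpow (Or.inr hs) hm hmM
  have ha := isStrictlyPositive_of_smul_one_le hm h1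
  have hb := ha.of_le hab
  calc a ^ s ≤ α • a + β • (1 : A) := by
        rw [CFC.rpow_eq_cfc_real (ha := ha.nonneg)]
        exact cfc_le_affine ha.isSelfAdjoint (continuousOn_rpow_spectrum ha s)
          fun t ht => hα t (mem_Icc_of_mem_spectrum h1 h2 ht)
    _ ≤ α • b + β • (1 : A) := by
        gcongr
        exact h0 hs
    _ ≤ cfc (fun t : ℝ => kantorovich (M / m) s * t ^ s) b :=
        affine_le_cfc hb.isSelfAdjoint (continuousOn_const.mul (continuousOn_rpow_spectrum hb s))
          fun t ht => hβ t (hb.spectrum_pos ht)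
    _ = _ := by
        rw [cfc_const_mul _ _ _ (continuousOn_rpow_spectrum hb s),
          CFC.rpow_eq_cfc_real (ha := hb.nonneg)]

/-- The exponential function preserves the order up to the Specht ratio. -/
theorem exp_le_specht_smul_exp {a b : A} {m M : ℝ} (hm : 0 < m) (hmM : m < M)
    (h1 : Real.log m • (1 : A) ≤ a) (h2 : a ≤ Real.log M • (1 : A)) (hab : a ≤ b) :
    NormedSpace.exp a ≤ specht (M / m) • NormedSpace.exp b := by
  obtain ⟨α, β, h0, hα, hβ⟩ := exists_affine_between_exp hm hmM
  have ha := isSelfAdjoint_of_smul_one_le h1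
  have hb := isSelfAdjoint_of_smul_one_le (h1.trans hab)
  rw [← CFC.real_exp_eq_normedSpace_exp ha, ← CFC.real_exp_eq_normedSpace_exp hb]
  calc cfc Real.exp a ≤ α • a + β • (1 : A) :=
        cfc_le_affine ha Real.continuous_exp.continuousOn
          fun t ht => hα t (mem_Icc_of_mem_spectrum h1 h2 ht)
    _ ≤ α • b + β • (1 : A) := by gcongr
    _ ≤ cfc (fun t : ℝ => specht (M / m) * Real.exp t) b :=
        affine_le_cfc hb (by fun_prop) fun t _ => hβ t
    _ = _ := cfc_const_mul _ _ _ (by fun_prop)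

end CStar

/-! ### Kantorovich and Specht bounds from the harmonic–arithmetic sandwich -/

section CStarBounds

variable {A : Type*} [CStarAlgebra A] [PartialOrder A] [StarOrderedRing A]
  {ι : Type*} [Fintype ι] {ω : ι → ℝ}

theorem rpow_le_smul_rpow_of_le_smul {a b : A} {k s : ℝ} (hk : 0 < k) (hs : s ∈ Set.Icc (0 : ℝ) 1)
    (hb : IsStrictlyPositive b) (h : a ≤ k • b) : a ^ s ≤ k ^ s • b ^ s := by
  rw [← smul_rpow hk hb]
  exact CFC.rpow_le_rpow hs h

theorem inv_smul_le_of_le_smul {a b : A} {k : ℝ} (hk : 0 < k) (h : a ≤ k • b) : k⁻¹ • a ≤ b := by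
  simpa [smul_smul, inv_mul_cancel₀ hk.ne'] using
    smul_le_smul_of_nonneg_left h (inv_nonneg.2 hk.le)

theorem rpow_neg_one_rpow {a : A} (ha : IsStrictlyPositive a) (s : ℝ) :
    (a ^ (-1 : ℝ)) ^ s = a ^ (-s) := by
  rw [CFC.rpow_rpow a _ _ (by norm_num), neg_one_mul]

variable (hω : ∀ j, 0 ≤ ω j) (hω1 : ∑ j, ω j = 1) {a : ι → A} {m M : ℝ} (hm : 0 < m)
  (hmM : m < M) (ha : ∀ j, m • (1 : A) ≤ a j) (ha' : ∀ j, a j ≤ M • (1 : A))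

include hω hω1 hm hmM ha ha'

/-- Write a^q as the power -q/p of a^(-p). The latter lies between M^(-p) and m^(-p), whose ratio is
h^p; hence the first argument of the constant. -/
theorem sum_rpow_le_smul_sum_rpow_neg_rpow {p q : ℝ} (hq : 0 < q) (hp : 0 < p) :
    ∑ j, ω j • a j ^ q ≤
      kantorovich ((M / m) ^ p) (-(q / p)) • (∑ j, ω j • a j ^ (-p)) ^ (-(q / p)) := by
  have hM : 0 < M := hm.trans hmM
  have hsp := fun j => isStrictlyPositive_of_smul_one_le hm (ha j)
  have key := sum_rpow_le_kantorovich_smul hω hω1 (C := fun j => a j ^ (-p)) (r := -(q / p))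
    (neg_lt_zero.2 (div_pos hq hp)) (Real.rpow_pos_of_pos hM (-p))
    (Real.rpow_lt_rpow_of_neg hm hmM (neg_lt_zero.2 hp))
    (fun j => smul_one_le_rpow_of_nonpos (neg_nonpos.2 hp.le) (hsp j) (ha' j))
    (fun j => rpow_le_smul_one_of_nonpos hm (neg_nonpos.2 hp.le) (ha j))
  have e1 : m ^ (-p) / M ^ (-p) = (M / m) ^ p := by
    rw [Real.rpow_neg hm.le, Real.rpow_neg hM.le, Real.div_rpow hM.le hm.le, inv_div_inv]
  have e2 : ∀ j, (a j ^ (-p)) ^ (-(q / p)) = a j ^ q := fun j => by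
    rw [CFC.rpow_rpow _ _ _ (neg_ne_zero.2 hp.ne') (hsp j)]
    congr 1
    field_simp
  simpa only [e1, e2] using key

theorem sum_rpow_neg_le_smul_sum_rpow_rpow {p q : ℝ} (hq : 0 < q) (hp : 0 < p) :
    ∑ j, ω j • a j ^ (-q) ≤
      kantorovich ((M / m) ^ p) (-(q / p)) • (∑ j, ω j • a j ^ p) ^ (-(q / p)) := by
  have hM : 0 < M := hm.trans hmM
  have hsp := fun j => isStrictlyPositive_of_smul_one_le hm (ha j)
  have key := sum_rpow_le_kantorovich_smul hω hω1 (C := fun j => a j ^ p) (r := -(q / p))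
    (neg_lt_zero.2 (div_pos hq hp)) (Real.rpow_pos_of_pos hm p)
    (Real.rpow_lt_rpow hm.le hmM hp)
    (fun j => smul_one_le_rpow hm hp.le (ha j))
    (fun j => rpow_le_smul_one hp.le (hsp j) (ha' j))
  have e1 : M ^ p / m ^ p = (M / m) ^ p := (Real.div_rpow hM.le hm.le p).symm
  have e2 : ∀ j, (a j ^ p) ^ (-(q / p)) = a j ^ (-q) := fun j => by
    rw [CFC.rpow_rpow _ _ _ hp.ne' (hsp j)]
    congr 1
    field_simp
  simpa only [e1, e2] using key

theorem one_le_kantorovich_rpow {p q : ℝ} (hq : 0 < q) (hp : 0 < p) :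
    1 ≤ kantorovich ((M / m) ^ p) (-(q / p)) :=
  one_le_kantorovich (Or.inl (neg_lt_zero.2 (div_pos hq hp)))
    (Real.one_lt_rpow ((one_lt_div hm).2 hmM) hp)

/-- Here and below X stands for the deformed mean of the p-th powers and Y for that of the q-th
powers. The reverse Jensen bound for Y is a power q/p of the harmonic mean below X, and q/p ≤ 1
allows Löwner–Heinz. -/
theorem le_smul_rpow_div_of_harm_le {p q : ℝ} (hq : 0 < q) (hqp : q ≤ p) {X Y : A}
    (hX : (∑ j, ω j • a j ^ (-p)) ^ (-1 : ℝ) ≤ X) (hY : Y ≤ ∑ j, ω j • a j ^ q) :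
    Y ≤ kantorovich ((M / m) ^ p) (-(q / p)) • X ^ (q / p) := by
  have hM : 0 < M := hm.trans hmM
  have hp : 0 < p := hq.trans_le hqp
  have hsp := fun j => isStrictlyPositive_of_smul_one_le hm (ha j)
  have hS : IsStrictlyPositive (∑ j, ω j • a j ^ (-p)) :=
    isStrictlyPositive_of_smul_one_le (Real.rpow_pos_of_pos hM (-p)) (smul_one_le_sum hω hω1
      fun j => smul_one_le_rpow_of_nonpos (neg_nonpos.2 hp.le) (hsp j) (ha' j))
  refine (hY.trans (sum_rpow_le_smul_sum_rpow_neg_rpow hω hω1 hm hmM ha ha' hq hp)).trans ?_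
  refine smul_le_smul_of_nonneg_left ?_
    (zero_le_one.trans (one_le_kantorovich_rpow hω hω1 hm hmM ha ha' hq hp))
  rw [← rpow_neg_one_rpow hS]
  exact CFC.rpow_le_rpow ⟨(div_pos hq hp).le, (div_le_one hp).2 hqp⟩ hX

/-- The dual chain: X^(q/p) ≤ (∑ ω_j a_j^p)^(q/p) by Löwner–Heinz, and inverting the reverse Jensen
inequality bounds this by K times the harmonic mean below Y. -/
theorem rpow_div_le_smul_of_le_arith {p q : ℝ} (hq : 0 < q) (hqp : q ≤ p) {X Y : A}
    (hY : (∑ j, ω j • a j ^ (-q)) ^ (-1 : ℝ) ≤ Y) (hX : X ≤ ∑ j, ω j • a j ^ p) :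
    X ^ (q / p) ≤ kantorovich ((M / m) ^ p) (-(q / p)) • Y := by
  have hM : 0 < M := hm.trans hmM
  have hp : 0 < p := hq.trans_le hqp
  have hsp := fun j => isStrictlyPositive_of_smul_one_le hm (ha j)
  have hK := one_pos.trans_le (one_le_kantorovich_rpow hω hω1 hm hmM ha ha' hq hp)
  have hS : IsStrictlyPositive (∑ j, ω j • a j ^ (-q)) :=
    isStrictlyPositive_of_smul_one_le (Real.rpow_pos_of_pos hM (-q)) (smul_one_le_sum hω hω1
      fun j => smul_one_le_rpow_of_nonpos (neg_nonpos.2 hq.le) (hsp j) (ha' j))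
  have hT : IsStrictlyPositive (∑ j, ω j • a j ^ p) :=
    isStrictlyPositive_of_smul_one_le (Real.rpow_pos_of_pos hm p) (smul_one_le_sum hω hω1
      fun j => smul_one_le_rpow hm hp.le (ha j))
  have h1 := CStarAlgebra.rpow_neg_one_le_rpow_neg_one
    (sum_rpow_neg_le_smul_sum_rpow_rpow hω hω1 hm hmM ha ha' hq hp) hS
  rw [smul_rpow hK (hT.rpow _ _), CFC.rpow_rpow _ _ _ (neg_ne_zero.2 (div_pos hq hp).ne') hT,
    neg_mul_neg, mul_one, Real.rpow_neg_one] at h1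
  have h2 := smul_le_smul_of_nonneg_left (h1.trans hY) hK.le
  rw [smul_smul, mul_inv_cancel₀ hK.ne', one_smul] at h2
  exact (CFC.rpow_le_rpow ⟨(div_pos hq hp).le, (div_le_one hp).2 hqp⟩ hX).trans h2

theorem smul_one_le_of_harm_le {p : ℝ} (hp : 0 < p) {X : A}
    (hX : (∑ j, ω j • a j ^ (-p)) ^ (-1 : ℝ) ≤ X) : m ^ p • (1 : A) ≤ X := by
  have hM : 0 < M := hm.trans hmM
  have hsp := fun j => isStrictlyPositive_of_smul_one_le hm (ha j)
  have hS : IsStrictlyPositive (∑ j, ω j • a j ^ (-p)) :=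
    isStrictlyPositive_of_smul_one_le (Real.rpow_pos_of_pos hM (-p)) (smul_one_le_sum hω hω1
      fun j => smul_one_le_rpow_of_nonpos (neg_nonpos.2 hp.le) (hsp j) (ha' j))
  have h := smul_one_le_rpow_of_nonpos (p := -1) (by norm_num) hS
    (sum_le_smul_one hω hω1
      fun j => rpow_le_smul_one_of_nonpos hm (neg_nonpos.2 hp.le) (ha j))
  rw [← Real.rpow_mul hm.le, neg_mul_neg, mul_one] at h
  exact h.trans hX

theorem le_smul_one_of_le_arith {p : ℝ} (hp : 0 < p) {X : A}
    (hX : X ≤ ∑ j, ω j • a j ^ p) : X ≤ M ^ p • (1 : A) :=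
  hX.trans (sum_le_smul_one hω hω1 fun j =>
    rpow_le_smul_one hp.le (isStrictlyPositive_of_smul_one_le hm (ha j)) (ha' j))

variable {X Y : A} {p q : ℝ}
  (hX1 : (∑ j, ω j • a j ^ (-p)) ^ (-1 : ℝ) ≤ X) (hX2 : X ≤ ∑ j, ω j • a j ^ p)
  (hY1 : (∑ j, ω j • a j ^ (-q)) ^ (-1 : ℝ) ≤ Y) (hY2 : Y ≤ ∑ j, ω j • a j ^ q)

include hX1 hX2 hY1 hY2

theorem kantorovich_bounds_of_one_le (hq : 1 ≤ q) (hqp : q ≤ p) :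
    kantorovich ((M / m) ^ p) (-(q / p)) ^ (-(1 / q)) • X ^ (1 / p) ≤ Y ^ (1 / q) ∧
    Y ^ (1 / q) ≤ kantorovich ((M / m) ^ p) (-(q / p)) ^ (1 / q) • X ^ (1 / p) := by
  have hq0 : 0 < q := by linarith
  have hp0 : 0 < p := by linarith
  have hX := isStrictlyPositive_of_smul_one_le (Real.rpow_pos_of_pos hm p)
    (smul_one_le_of_harm_le hω hω1 hm hmM ha ha' hp0 hX1)
  have hY := isStrictlyPositive_of_smul_one_le (Real.rpow_pos_of_pos hm q)
    (smul_one_le_of_harm_le hω hω1 hm hmM ha ha' hq0 hY1)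
  have hK := one_pos.trans_le (one_le_kantorovich_rpow hω hω1 hm hmM ha ha' hq0 hp0)
  -- This is where 1 ≤ q enters: the power 1/q is operator monotone.
  have hs : 1 / q ∈ Set.Icc (0 : ℝ) 1 := ⟨by positivity, (div_le_one hq0).2 hq⟩
  have e : (X ^ (q / p)) ^ (1 / q) = X ^ (1 / p) := by
    rw [CFC.rpow_rpow _ _ _ (div_pos hq0 hp0).ne' hX]
    congr 1
    field_simp
  constructor
  · rw [Real.rpow_neg hK.le]
    refine inv_smul_le_of_le_smul (Real.rpow_pos_of_pos hK _) ?_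
    rw [← e]
    exact rpow_le_smul_rpow_of_le_smul hK hs hY
      (rpow_div_le_smul_of_le_arith hω hω1 hm hmM ha ha' hq0 hqp hY1 hX2)
  · rw [← e]
    exact rpow_le_smul_rpow_of_le_smul hK hs (hX.rpow _ _)
      (le_smul_rpow_div_of_harm_le hω hω1 hm hmM ha ha' hq0 hqp hX1 hY2)

theorem kantorovich_bounds_of_lt_one (hq0 : 0 < q) (hq : q < 1) (hqp : q < p) :
    ((kantorovich ((M / m) ^ q) (1 / q))⁻¹ *
        kantorovich ((M / m) ^ p) (-(q / p)) ^ (-(1 / q))) • X ^ (1 / p) ≤ Y ^ (1 / q) ∧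
    Y ^ (1 / q) ≤ (kantorovich ((M / m) ^ q) (1 / q) *
        kantorovich ((M / m) ^ p) (-(q / p)) ^ (1 / q)) • X ^ (1 / p) := by
  have hM : 0 < M := hm.trans hmM
  have hp0 : 0 < p := by linarith
  have hX' := smul_one_le_of_harm_le hω hω1 hm hmM ha ha' hp0 hX1
  have hX'' := le_smul_one_of_le_arith hω hω1 hm hmM ha ha' hp0 hX2
  have hY' := smul_one_le_of_harm_le hω hω1 hm hmM ha ha' hq0 hY1
  have hY'' := le_smul_one_of_le_arith hω hω1 hm hmM ha ha' hq0 hY2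
  have hX := isStrictlyPositive_of_smul_one_le (Real.rpow_pos_of_pos hm p) hX'
  have hY := isStrictlyPositive_of_smul_one_le (Real.rpow_pos_of_pos hm q) hY'
  have hK := one_pos.trans_le (one_le_kantorovich_rpow hω hω1 hm hmM ha ha' hq0 hp0)
  -- The power 1/q is no longer covered by Löwner–Heinz. Furuta's inequality replaces it; its
  -- smaller operator, X^(q/p) or Y, lies in [m^q, M^q], whence K(h^q, 1/q).
  have hs : 1 < 1 / q := (one_lt_div hq0).2 hq
  have hh : 1 < (M / m) ^ q := Real.one_lt_rpow ((one_lt_div hm).2 hmM) hq0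
  have hK' := one_pos.trans_le (one_le_kantorovich (Or.inr hs) hh)
  have e : (X ^ (q / p)) ^ (1 / q) = X ^ (1 / p) := by
    rw [CFC.rpow_rpow _ _ _ (div_pos hq0 hp0).ne' hX]
    congr 1
    field_simp
  have eM : M ^ q / m ^ q = (M / m) ^ q := (Real.div_rpow hM.le hm.le q).symm
  have hmq := Real.rpow_pos_of_pos hm q
  have hmMq : m ^ q < M ^ q := Real.rpow_lt_rpow hm.le hmM hq0
  constructor
  · rw [Real.rpow_neg hK.le, ← mul_inv]
    refine inv_smul_le_of_le_smul (mul_pos hK' (Real.rpow_pos_of_pos hK _)) ?_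
    have b1 := smul_one_le_rpow (p := q / p) (Real.rpow_pos_of_pos hm p) (by positivity) hX'
    have b2 := rpow_le_smul_one (p := q / p) (by positivity) hX hX''
    rw [← Real.rpow_mul hm.le, mul_div_cancel₀ _ hp0.ne'] at b1
    rw [← Real.rpow_mul hM.le, mul_div_cancel₀ _ hp0.ne'] at b2
    have := rpow_le_kantorovich_smul_rpow hs hmq hmMq b1 b2
      (rpow_div_le_smul_of_le_arith hω hω1 hm hmM ha ha' hq0 hqp.le hY1 hX2)
    rwa [e, smul_rpow hK hY, smul_smul, eM] at this
  · have := rpow_le_kantorovich_smul_rpow hs hmq hmMq hY' hY''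
      (le_smul_rpow_div_of_harm_le hω hω1 hm hmM ha ha' hq0 hqp.le hX1 hY2)
    rwa [smul_rpow hK (hX.rpow _ _), e, smul_smul, eM] at this

omit hY1 hY2

/-- Let L = ∑ ω_j log a_j. Operator monotonicity of log, applied to the two sides of the sandwich,
and reverse Jensen for log give pL - log S(h^p) ≤ log X ≤ pL + log S(h^p). Dividing by p and
exponentiating, at the price S(h), yields both bounds. -/
theorem specht_bounds (hp0 : 0 < p) :
    ((specht (M / m))⁻¹ * specht ((M / m) ^ p) ^ (-(1 / p))) • X ^ (1 / p)
      ≤ NormedSpace.exp (∑ j, ω j • CFC.log (a j)) ∧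
    NormedSpace.exp (∑ j, ω j • CFC.log (a j))
      ≤ (specht (M / m) * specht ((M / m) ^ p) ^ (1 / p)) • X ^ (1 / p) := by
  have hM : 0 < M := hm.trans hmM
  have hsp := fun j => isStrictlyPositive_of_smul_one_le hm (ha j)
  have hX' := smul_one_le_of_harm_le hω hω1 hm hmM ha ha' hp0 hX1
  have hX'' := le_smul_one_of_le_arith hω hω1 hm hmM ha ha' hp0 hX2
  have hX := isStrictlyPositive_of_smul_one_le (Real.rpow_pos_of_pos hm p) hX'
  have hh1 : 1 < M / m := (one_lt_div hm).2 hmM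
  have hhp : 1 < (M / m) ^ p := Real.one_lt_rpow hh1 hp0
  have hS := one_pos.trans_le (one_le_specht hh1)
  have hSp := one_pos.trans_le (one_le_specht hhp)
  have hlog1 : ∀ {b : A} {c : ℝ}, 0 < c → c • (1 : A) ≤ b → Real.log c • (1 : A) ≤ CFC.log b :=
    fun {b c} hc hb => by
      have := CFC.log_le_log hb (isStrictlyPositive_of_smul_one_le hc le_rfl)
      rwa [← Algebra.algebraMap_eq_smul_one, CFC.log_algebraMap,
        Algebra.algebraMap_eq_smul_one] at this
  have hlog2 : ∀ {b : A} {c : ℝ}, IsStrictlyPositive b → b ≤ c • (1 : A) →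
      CFC.log b ≤ Real.log c • (1 : A) := fun {b c} hb hc => by
      have := CFC.log_le_log hc hb
      rwa [← Algebra.algebraMap_eq_smul_one, CFC.log_algebraMap,
        Algebra.algebraMap_eq_smul_one] at this
  have hlogr : ∀ {b : A} (s : ℝ), IsStrictlyPositive b → CFC.log (b ^ s) = s • CFC.log b :=
    fun {b} s hb => by
      have hlc : ContinuousOn Real.log (spectrum ℝ b) :=
        Real.continuousOn_log.mono fun t ht => (hb.spectrum_pos ht).ne'
      have hlc' : ContinuousOn Real.log ((fun t : ℝ => t ^ s) '' spectrum ℝ b) := by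
        refine Real.continuousOn_log.mono ?_
        rintro _ ⟨t, ht, rfl⟩
        exact (Real.rpow_pos_of_pos (hb.spectrum_pos ht) s).ne'
      rw [CFC.rpow_eq_cfc_real (ha := hb.nonneg), CFC.log, CFC.log,
        ← cfc_comp' Real.log (fun t : ℝ => t ^ s) b hlc' (continuousOn_rpow_spectrum hb s)
          hb.isSelfAdjoint, ← cfc_smul s Real.log b hlc]
      exact cfc_congr fun t ht => Real.log_rpow (hb.spectrum_pos ht) s
  set L := ∑ j, ω j • CFC.log (a j) with hLdef
  have hL1 : Real.log m • (1 : A) ≤ L := smul_one_le_sum hω hω1 fun j => hlog1 hm (ha j)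
  have hL2 : L ≤ Real.log M • (1 : A) := sum_le_smul_one hω hω1 fun j => hlog2 (hsp j) (ha' j)
  have hLsa : IsSelfAdjoint L := isSelfAdjoint_of_smul_one_le hL1
  have hsumlog : ∀ s : ℝ, ∑ j, ω j • CFC.log (a j ^ s) = s • L := fun s => by
    simp_rw [hlogr s (hsp _), hLdef, Finset.smul_sum, smul_comm s]
  have hXp := hX.rpow _ (1 / p)
  have hk := Real.rpow_pos_of_pos hSp (1 / p)
  have hklog : Real.log (specht ((M / m) ^ p) ^ (1 / p))
      = p⁻¹ * Real.log (specht ((M / m) ^ p)) := by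
    rw [Real.log_rpow hSp, one_div]
  constructor
  · rw [Real.rpow_neg hSp.le, ← mul_inv]
    refine inv_smul_le_of_le_smul (mul_pos hS hk) ?_
    have h1 := log_sum_le hω hω1 (C := fun j => a j ^ p) (Real.rpow_pos_of_pos hm p)
      (Real.rpow_lt_rpow hm.le hmM hp0) (fun j => smul_one_le_rpow hm hp0.le (ha j))
      (fun j => rpow_le_smul_one hp0.le (hsp j) (ha' j))
    rw [hsumlog, ← Real.div_rpow hM.le hm.le] at h1
    have h2 := smul_le_smul_of_nonneg_left ((CFC.log_le_log hX2 hX).trans h1)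
      (inv_nonneg.2 hp0.le)
    have hE : IsStrictlyPositive (NormedSpace.exp L) := by
      rw [← CFC.real_exp_eq_normedSpace_exp hLsa]
      refine isStrictlyPositive_of_smul_one_le hm ?_
      rw [← Algebra.algebraMap_eq_smul_one]
      exact algebraMap_le_cfc _ _ _ (fun x hx =>
        (Real.le_exp_log m).trans (Real.exp_le_exp.2 (mem_Icc_of_mem_spectrum hL1 hL2 hx).1))
    have h3 : CFC.log (X ^ (1 / p))
        ≤ CFC.log (specht ((M / m) ^ p) ^ (1 / p) • NormedSpace.exp L) := by
      rw [hlogr _ hX, CFC.log_smul' _ hk hE, CFC.log_exp L hLsa, hklog,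
        Algebra.algebraMap_eq_smul_one, one_div, add_comm]
      simpa [smul_add, smul_smul, inv_mul_cancel₀ hp0.ne'] using h2
    -- X^(1/p) lies in [m, M], so exponentiating costs S(h) and not S(h^p).
    have b1 := smul_one_le_rpow (p := 1 / p) (Real.rpow_pos_of_pos hm p) (by positivity) hX'
    have b2 := rpow_le_smul_one (p := 1 / p) (by positivity) hX hX''
    rw [← Real.rpow_mul hm.le, mul_one_div_cancel hp0.ne', Real.rpow_one] at b1
    rw [← Real.rpow_mul hM.le, mul_one_div_cancel hp0.ne', Real.rpow_one] at b2
    have := exp_le_specht_smul_exp hm hmM (hlog1 hm b1) (hlog2 hXp b2) h3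
    rwa [CFC.exp_log _ hXp, CFC.exp_log _ (hE.smul hk), smul_smul] at this
  · have hS' : IsStrictlyPositive (∑ j, ω j • a j ^ (-p)) :=
      isStrictlyPositive_of_smul_one_le (Real.rpow_pos_of_pos hM (-p)) (smul_one_le_sum hω hω1
        fun j => smul_one_le_rpow_of_nonpos (neg_nonpos.2 hp0.le) (hsp j) (ha' j))
    have h1 := log_sum_le hω hω1 (C := fun j => a j ^ (-p)) (Real.rpow_pos_of_pos hM (-p))
      (Real.rpow_lt_rpow_of_neg hm hmM (neg_lt_zero.2 hp0))
      (fun j => smul_one_le_rpow_of_nonpos (neg_nonpos.2 hp0.le) (hsp j) (ha' j))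
      (fun j => rpow_le_smul_one_of_nonpos hm (neg_nonpos.2 hp0.le) (ha j))
    have e1 : m ^ (-p) / M ^ (-p) = (M / m) ^ p := by
      rw [Real.rpow_neg hm.le, Real.rpow_neg hM.le, Real.div_rpow hM.le hm.le, inv_div_inv]
    rw [hsumlog, e1] at h1
    have h2 := CFC.log_le_log hX1 (hS'.rpow _ _)
    rw [hlogr _ hS'] at h2
    have h3 : L ≤ CFC.log (specht ((M / m) ^ p) ^ (1 / p) • X ^ (1 / p)) := by
      rw [CFC.log_smul' _ hk hXp, hlogr _ hX, hklog, Algebra.algebraMap_eq_smul_one, one_div]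
      have h4 : p • L ≤ Real.log (specht ((M / m) ^ p)) • (1 : A) + CFC.log X := by
        have h5 := neg_le_neg h1
        have h6 : -CFC.log (∑ j, ω j • a j ^ (-p)) ≤ CFC.log X := by simpa using h2
        have h7 := h5.trans h6
        rw [neg_add, neg_smul, neg_neg, add_neg_le_iff_le_add] at h7
        rwa [add_comm]
      have h8 := smul_le_smul_of_nonneg_left h4 (inv_nonneg.2 hp0.le)
      simpa [smul_add, smul_smul, inv_mul_cancel₀ hp0.ne'] using h8
    have := exp_le_specht_smul_exp hm hmM hL1 hL2 h3
    rwa [CFC.exp_log _ (hXp.smul hk), smul_smul] at this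

end CStarBounds

/-! ### Fixed points of Thompson-type contractions on an order interval -/

section FixedPoint

variable {A : Type*} [CStarAlgebra A] [PartialOrder A] [StarOrderedRing A]
  {Φ : A → A} {k K ρ : ℝ}

theorem le_one_add_smul_of_mem_Icc (hk : 0 < k) {X Y : A} (hX : X ≤ K • (1 : A))
    (hY : k • (1 : A) ≤ Y) (hkK : k ≤ K) : X ≤ (1 + (K / k - 1)) • Y := by
  have h := smul_le_smul_of_nonneg_left hY (div_nonneg (hk.le.trans hkK) hk.le)
  rw [smul_smul, div_mul_cancel₀ _ hk.ne'] at h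
  rw [add_sub_cancel]
  exact hX.trans h

/-- A map of the order interval `[k, K]` that contracts the Thompson metric has at most one
fixed point. -/
theorem fixedPoint_le_of_contraction (hk : 0 < k) (hkK : k ≤ K) (hρ0 : 0 ≤ ρ) (hρ1 : ρ < 1)
    (hΦ : ∀ X Y : A, X ∈ Set.Icc (k • (1 : A)) (K • 1) → Y ∈ Set.Icc (k • (1 : A)) (K • 1) →
      ∀ a : ℝ, 0 ≤ a → X ≤ (1 + a) • Y → Φ X ≤ (1 + ρ * a) • Φ Y)
    {X Y : A} (hX : X ∈ Set.Icc (k • (1 : A)) (K • 1)) (hY : Y ∈ Set.Icc (k • (1 : A)) (K • 1))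
    (hXf : Φ X = X) (hYf : Φ Y = Y) : X ≤ Y := by
  have ha : 0 ≤ K / k - 1 := sub_nonneg.2 ((one_le_div hk).2 hkK)
  have key : ∀ n : ℕ, X ≤ (1 + ρ ^ n * (K / k - 1)) • Y := fun n => by
    induction n with
    | zero => simpa only [pow_zero, one_mul] using le_one_add_smul_of_mem_Icc hk hX.2 hY.1 hkK
    | succ n ih =>
      have := hΦ X Y hX hY _ (by positivity) ih
      rwa [hXf, hYf, ← mul_assoc, ← pow_succ'] at this
  have hlim : Tendsto (fun n : ℕ => (1 + ρ ^ n * (K / k - 1)) • Y) atTop (𝓝 Y) := by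
    have h1 := ((tendsto_pow_atTop_nhds_zero_of_lt_one hρ0 hρ1).mul_const (K / k - 1)).const_add 1
    simpa using h1.smul_const Y
  exact ge_of_tendsto' hlim key

/-- Iterate from the bottom k of the interval. The case a = 0 of the contraction is monotonicity, so
the iterates increase; their ratios tend to 1 geometrically, which makes the sequence norm-Cauchy.
No continuity of Φ is assumed: the limit is compared with the iterates in order. -/
theorem exists_fixedPoint_of_contraction (hk : 0 < k) (hkK : k ≤ K) (hρ0 : 0 ≤ ρ) (hρ1 : ρ < 1)
    (hmaps : ∀ X ∈ Set.Icc (k • (1 : A)) (K • 1), Φ X ∈ Set.Icc (k • (1 : A)) (K • 1))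
    (hΦ : ∀ X Y : A, X ∈ Set.Icc (k • (1 : A)) (K • 1) → Y ∈ Set.Icc (k • (1 : A)) (K • 1) →
      ∀ a : ℝ, 0 ≤ a → X ≤ (1 + a) • Y → Φ X ≤ (1 + ρ * a) • Φ Y) :
    ∃ X ∈ Set.Icc (k • (1 : A)) (K • 1), Φ X = X := by
  have hK : 0 < K := hk.trans_le hkK
  have mono : ∀ X Y : A, X ∈ Set.Icc (k • (1 : A)) (K • 1) → Y ∈ Set.Icc (k • (1 : A)) (K • 1) →
      X ≤ Y → Φ X ≤ Φ Y := fun X Y hX hY h => by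
    simpa using hΦ X Y hX hY 0 le_rfl (by simpa using h)
  set x : ℕ → A := fun n => Φ^[n] (k • 1) with hx
  have hxs : ∀ n, x (n + 1) = Φ (x n) := fun n => Function.iterate_succ_apply' Φ n _
  have hmem : ∀ n, x n ∈ Set.Icc (k • (1 : A)) (K • 1) := fun n => by
    induction n with
    | zero => exact ⟨le_rfl, smul_one_le_smul_one hkK⟩
    | succ n ih => rw [hxs]; exact hmaps _ ih
  have hstep : ∀ n, x n ≤ x (n + 1) := fun n => by
    induction n with
    | zero => exact (hmem 1).1
    | succ n ih => rw [hxs, hxs (n + 1)]; exact mono _ _ (hmem _) (hmem _) ih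
  have ha : 0 ≤ K / k - 1 := sub_nonneg.2 ((one_le_div hk).2 hkK)
  have hup : ∀ n, x (n + 1) ≤ (1 + ρ ^ n * (K / k - 1)) • x n := fun n => by
    induction n with
    | zero =>
      simpa only [pow_zero, one_mul] using
        le_one_add_smul_of_mem_Icc hk (hmem 1).2 (hmem 0).1 hkK
    | succ n ih =>
      have := hΦ _ _ (hmem _) (hmem _) _ (by positivity) ih
      rwa [← hxs, ← hxs, ← mul_assoc, ← pow_succ'] at this
  have hdist : ∀ n, dist (x n) (x (n + 1)) ≤ (K / k - 1) * K * ρ ^ n := fun n => by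
    rw [dist_comm, dist_eq_norm, CStarAlgebra.norm_le_iff_le_algebraMap _ (by positivity)
      (sub_nonneg.2 (hstep n)), Algebra.algebraMap_eq_smul_one]
    have h1 := hup n
    rw [add_smul, one_smul] at h1
    have h2 : (ρ ^ n * (K / k - 1)) • x n ≤ (ρ ^ n * (K / k - 1)) • (K • (1 : A)) :=
      smul_le_smul_of_nonneg_left (hmem n).2 (by positivity)
    rw [smul_smul] at h2
    calc _ ≤ (ρ ^ n * (K / k - 1)) • x n := sub_le_iff_le_add'.2 h1
      _ ≤ _ := h2
      _ = _ := by congr 1; ring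
  obtain ⟨X, hX⟩ := cauchySeq_tendsto_of_complete
    (cauchySeq_of_le_geometric ρ ((K / k - 1) * K) hρ1 hdist)
  have hXmem : X ∈ Set.Icc (k • (1 : A)) (K • 1) :=
    ⟨ge_of_tendsto' hX fun n => (hmem n).1, le_of_tendsto' hX fun n => (hmem n).2⟩
  have hle : ∀ n, x n ≤ X := fun n =>
    (monotone_nat_of_le_succ hstep).ge_of_tendsto hX n
  have hXs : Tendsto (fun n => x (n + 1)) atTop (𝓝 X) := (tendsto_add_atTop_iff_nat 1).2 hX
  refine ⟨X, hXmem, le_antisymm ?_ (le_of_tendsto' hXs fun n => ?_)⟩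
  · have hnorm : Tendsto (fun n => ‖X - x n‖ / k) atTop (𝓝 0) := by
      have := (tendsto_const_nhds (x := X)).sub hX
      rw [sub_self] at this
      simpa using this.norm.div_const k
    -- Since x n ≥ k, norm convergence becomes multiplicative domination, to which the contraction
    -- applies.
    have hXup : ∀ n, X ≤ (1 + ‖X - x n‖ / k) • x n := fun n => by
      have h1 := le_norm_smul_one (a := X - x n) (.of_nonneg (sub_nonneg.2 (hle n)))
      have h2 := smul_le_smul_of_nonneg_left (hmem n).1
        (div_nonneg (norm_nonneg (X - x n)) hk.le)
      rw [smul_smul, div_mul_cancel₀ _ hk.ne'] at h2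
      rw [add_smul, one_smul]
      exact sub_le_iff_le_add'.1 (h1.trans h2)
    have hlim : Tendsto (fun n => (1 + ρ * (‖X - x n‖ / k)) • x (n + 1)) atTop (𝓝 X) := by
      simpa using ((hnorm.const_mul ρ).const_add 1).smul hXs
    refine ge_of_tendsto' hlim fun n => ?_
    rw [hxs]
    exact hΦ _ _ hXmem (hmem n) _ (by positivity) (hXup n)
  · rw [hxs]
    exact mono _ _ (hmem n) hXmem (hle n)

end FixedPoint

/-! ### Order and commuting projections -/

section ProjectionOrder

variable {A : Type*} [CStarAlgebra A] [PartialOrder A] [StarOrderedRing A]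

theorem proj_mul_le_of_le {P X Y : A} (hP : IsStarProjection P) (hX : Commute P X)
    (hY : Commute P Y) (h : X ≤ Y) : P * X ≤ P * Y := by
  have := hP.isSelfAdjoint.conjugate_le_conjugate h
  rwa [hX.eq, mul_assoc, hP.isIdempotentElem.eq, ← hX.eq, hY.eq, mul_assoc,
    hP.isIdempotentElem.eq, ← hY.eq] at this

theorem proj_mul_add_one_sub_mul (P X : A) : P * X + (1 - P) * X = X := by
  rw [← add_mul, add_sub_cancel, one_mul]

/-- Replace the part of `B` under the projection `P` by the scalar `s`. -/
theorem commute_smul_add_one_sub_mul {P B : A} (hB : Commute P B) (s : ℝ) :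
    Commute P (s • P + (1 - P) * B) :=
  ((Commute.refl P).smul_right s).add_right
    (((Commute.one_right P).sub_right (Commute.refl P)).mul_right hB)

theorem proj_mul_smul_add_one_sub_mul {P : A} (hP : IsStarProjection P) (B : A) (s : ℝ) :
    P * (s • P + (1 - P) * B) = P * (s • (1 : A)) := by
  rw [mul_add, ← mul_assoc, hP.mul_one_sub_self, zero_mul, add_zero, mul_smul_comm,
    hP.isIdempotentElem.eq, mul_smul_comm, mul_one]

theorem isStrictlyPositive_smul_add_one_sub_mul {P B : A} (hP : IsStarProjection P)
    (hB : Commute P B) (hBp : IsStrictlyPositive B) {s : ℝ} (hs : 0 < s) :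
    IsStrictlyPositive (s • P + (1 - P) * B) := by
  obtain ⟨k, hk, hkB⟩ := exists_smul_one_le hBp
  refine isStrictlyPositive_of_smul_one_le (lt_min hs hk) ?_
  have h1 : min s k • P ≤ s • P := smul_le_smul_of_nonneg_right (min_le_left _ _) hP.nonneg
  have h2 : (1 - P) * (min s k • (1 : A)) ≤ (1 - P) * B :=
    proj_mul_le_of_le hP.one_sub ((Commute.one_right _).smul_right _)
      ((Commute.one_left B).sub_left hB)
      ((smul_one_le_smul_one (min_le_right _ _)).trans hkB)
  calc min s k • (1 : A) = min s k • P + (1 - P) * (min s k • (1 : A)) := by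
        rw [mul_smul_comm, mul_one, ← smul_add, add_sub_cancel]
    _ ≤ _ := add_le_add h1 h2

end ProjectionOrder

/-! ### Local monotone maps and comparison through symbols -/

section LocalMonotone

variable {H : Type*} [NormedAddCommGroup H] [InnerProductSpace ℂ H] [CompleteSpace H]

/-- An operator that is self-adjoint admits spectral projections: `E` is the projection onto
the orthogonal complement of the kernel of `(B - t)⁺`. -/
theorem exists_spectral_projection {B : H →L[ℂ] H} (hB : IsSelfAdjoint B) (t : ℝ) :
    ∃ E : H →L[ℂ] H, IsStarProjection E ∧
      (∀ S : H →L[ℂ] H, IsSelfAdjoint S → Commute S B → Commute S E) ∧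
      t • E ≤ E * B ∧ (1 - E) * B ≤ t • (1 - E) := by
  set D : H →L[ℂ] H := B - t • 1 with hD
  have hDsa : IsSelfAdjoint D := hB.sub ((IsSelfAdjoint.all t).smul (.one _))
  have hsub := CFC.posPart_sub_negPart D hDsa
  have hpn := CFC.posPart_mul_negPart D
  have hp := CFC.posPart_nonneg D
  have hn := CFC.negPart_nonneg D
  set C := D⁺ with hC
  set N := D⁻ with hN
  have : CompleteSpace C.ker := C.isClosed_ker.completeSpace_coe
  set Q : H →L[ℂ] H := C.ker.starProjection with hQdef
  have hQ : IsStarProjection Q := isStarProjection_starProjection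
  have hQmem : ∀ x, C (Q x) = 0 := fun x => C.ker.starProjection_apply_mem x
  have hQid : ∀ x, C x = 0 → Q x = x := fun x hx =>
    Submodule.starProjection_eq_self_iff.2 (LinearMap.mem_ker.2 hx)
  have hCQ : C * Q = 0 := ContinuousLinearMap.ext fun x => hQmem x
  -- C N = 0 places the range of N in the kernel of C, onto which Q projects.
  have hQN : Q * N = N := ContinuousLinearMap.ext fun x =>
    hQid _ (by simpa using congr($hpn x))
  have hQC : Q * C = 0 := by
    have := congr(star $hCQ)
    rwa [star_mul, hQ.isSelfAdjoint.star_eq, hp.isSelfAdjoint.star_eq, star_zero] at this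
  have hcomm : ∀ S : H →L[ℂ] H, IsSelfAdjoint S → Commute S B → Commute S Q := by
    intro S hS hSB
    have hSC : Commute S C := by
      have hSD : Commute D S := (hSB.sub_right ((Commute.one_right S).smul_right t)).symm
      rw [hC, CFC.posPart_def]
      exact (hSD.cfcₙ_real _).symm
    -- S commutes with C and so preserves its kernel; the adjoint of this identity gives commutation
    -- with Q.
    have h1 : Q * (S * Q) = S * Q := ContinuousLinearMap.ext fun x => by
      refine hQid _ ?_
      have := congr($hSC.eq (Q x))
      simp only [mul_apply_eq_comp, hQmem, map_zero] at this
      simpa using this.symm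
    have h2 := congr(star $h1)
    simp only [star_mul, hQ.isSelfAdjoint.star_eq, hS.star_eq] at h2
    exact (h1.symm.trans ((mul_assoc _ _ _).symm.trans h2))
  have hB' : B = C - N + t • 1 := by rw [hsub, hD, sub_add_cancel]
  refine ⟨1 - Q, hQ.one_sub, fun S hS hSB => (Commute.one_right S).sub_right (hcomm S hS hSB),
    ?_, ?_⟩
  · rw [← sub_nonneg]
    convert hp using 1
    rw [hB', mul_add, mul_sub, sub_mul, sub_mul, hQC, hQN, mul_smul_comm, mul_one]
    simp
  · rw [sub_sub_cancel, ← sub_nonneg]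
    convert hn using 1
    rw [hB', mul_add, mul_sub, hQC, hQN, mul_smul_comm, mul_one]
    abel

/-- A self-adjoint operator that commutes with every projection is a real scalar. -/
theorem exists_eq_smul_one_of_commute_projections {T : H →L[ℂ] H}
    (hT : IsSelfAdjoint T) (h : ∀ P : H →L[ℂ] H, IsStarProjection P → Commute P T) :
    ∃ c : ℝ, T = c • (1 : H →L[ℂ] H) := by
  rcases subsingleton_or_nontrivial H with hH | hH
  · exact ⟨0, ContinuousLinearMap.ext fun x => Subsingleton.elim _ _⟩
  -- Commuting with the rank-one projection onto v makes v an eigenvector; a linear map for which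
  -- every vector is an eigenvector is scalar.
  have hev : ∀ v : H, ∃ c : ℂ, T v = c • v := by
    intro v
    rcases eq_or_ne v 0 with rfl | hv
    · exact ⟨0, by simp⟩
    set u : H := ((‖v‖⁻¹ : ℝ) : ℂ) • v with hu
    have hu1 : ‖u‖ = 1 := by
      rw [hu, norm_smul, Complex.norm_real, norm_inv, norm_norm,
        inv_mul_cancel₀ (norm_ne_zero_iff.2 hv)]
    have h1 := congr($((h _ (InnerProductSpace.isStarProjection_rankOne_self (𝕜 := ℂ) hu1)).eq) u)
    simp only [mul_apply_eq_comp, InnerProductSpace.rankOne_apply,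
      inner_self_eq_norm_sq_to_K, hu1, map_smul] at h1
    have hvu : v = (‖v‖ : ℂ) • u := by
      rw [hu, smul_smul, ← Complex.ofReal_mul, mul_inv_cancel₀ (norm_ne_zero_iff.2 hv),
        Complex.ofReal_one, one_smul]
    refine ⟨inner ℂ u (T u), ?_⟩
    rw [hvu, map_smul, smul_comm, h1]
    simp
  obtain ⟨c, hc⟩ := LinearMap.exists_eq_smul_id_of_forall_notLinearIndependent
    (f := (T : H →ₗ[ℂ] H)) fun v hv => by
      obtain ⟨c, hc⟩ := hev v
      have := (LinearIndependent.pair_iff.1 hv) c (-1) (by simp [hc])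
      simp at this
  have hTc : ∀ x, T x = c • x := fun x => by simpa using congr($hc x)
  obtain ⟨x, hx⟩ := exists_ne (0 : H)
  have hre : (starRingEnd ℂ) c = c := by
    have h1 : inner ℂ (T x) x = inner ℂ x (T x) := by
      rw [← ContinuousLinearMap.adjoint_inner_right, ← ContinuousLinearMap.star_eq_adjoint,
        hT.star_eq]
    rw [hTc, inner_smul_left, inner_smul_right] at h1
    exact mul_right_cancel₀ (inner_self_ne_zero.2 hx) h1
  obtain ⟨r, rfl⟩ := Complex.conj_eq_iff_real.1 hre
  exact ⟨r, ContinuousLinearMap.ext fun x => by simp [hTc]⟩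

/-- A monotone map on positive invertible operators that is compatible with the decomposition of
an operator under the projections commuting with it. -/
structure IsLocalMonotone (G : (H →L[ℂ] H) → (H →L[ℂ] H)) : Prop where
  selfAdjoint : ∀ B, IsStrictlyPositive B → IsSelfAdjoint (G B)
  mono : ∀ B D, IsStrictlyPositive B → IsStrictlyPositive D → B ≤ D → G B ≤ G D
  commute : ∀ B P, IsStrictlyPositive B → IsStarProjection P → Commute P B → Commute P (G B)
  locality : ∀ B D P, IsStrictlyPositive B → IsStrictlyPositive D → IsStarProjection P →
    Commute P B → Commute P D → P * B = P * D → P * G B = P * G D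

/-- `g` describes the map `G` on positive scalar operators. -/
def HasSymbol (G : (H →L[ℂ] H) → (H →L[ℂ] H)) (g : ℝ → ℝ) : Prop :=
  ∀ t : ℝ, 0 < t → G (t • 1) = g t • 1

variable {G G₁ G₂ : (H →L[ℂ] H) → (H →L[ℂ] H)} {g g₁ g₂ : ℝ → ℝ}

theorem isStrictlyPositive_smul_one {t : ℝ} (ht : 0 < t) :
    IsStrictlyPositive (t • (1 : H →L[ℂ] H)) :=
  IsStrictlyPositive.smul ht isStrictlyPositive_one

theorem IsLocalMonotone.exists_hasSymbol (hG : IsLocalMonotone G) : ∃ g, HasSymbol G g := by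
  have : ∀ t : ℝ, ∃ c : ℝ, 0 < t → G (t • 1) = c • 1 := fun t => by
    by_cases ht : 0 < t
    · obtain ⟨c, hc⟩ := exists_eq_smul_one_of_commute_projections
        (hG.selfAdjoint _ (isStrictlyPositive_smul_one ht)) fun P hP =>
          hG.commute _ P (isStrictlyPositive_smul_one ht) hP ((Commute.one_right P).smul_right t)
      exact ⟨c, fun _ => hc⟩
    · exact ⟨0, fun h => absurd h ht⟩
  choose g hg using this
  exact ⟨g, hg⟩

theorem IsLocalMonotone.proj_mul_eq (hG : IsLocalMonotone G) (hg : HasSymbol G g)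
    {B P : H →L[ℂ] H} (hB : IsStrictlyPositive B) (hP : IsStarProjection P) (hPB : Commute P B)
    {s : ℝ} (hs : 0 < s) (h : P * B = s • P) : P * G B = g s • P := by
  rw [hG.locality B (s • 1) P hB (isStrictlyPositive_smul_one hs) hP hPB
    ((Commute.one_right P).smul_right s) (by simpa using h), hg s hs, mul_smul_comm, mul_one]

/-- Replacing the P-part of B by the scalar s gives an operator D ≤ B; by locality the P-part of G D
is g(s) P, and monotonicity concludes. -/
theorem IsLocalMonotone.le_proj_mul (hG : IsLocalMonotone G) (hg : HasSymbol G g)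
    {B P : H →L[ℂ] H} (hB : IsStrictlyPositive B) (hP : IsStarProjection P) (hPB : Commute P B)
    {s : ℝ} (hs : 0 < s) (h : s • P ≤ P * B) : g s • P ≤ P * G B := by
  set D := s • P + (1 - P) * B with hD
  have hDp : IsStrictlyPositive D := isStrictlyPositive_smul_add_one_sub_mul hP hPB hB hs
  have hPD : Commute P D := commute_smul_add_one_sub_mul hPB s
  have hDB : D ≤ B := by
    calc D ≤ P * B + (1 - P) * B := add_le_add_left h _
      _ = B := proj_mul_add_one_sub_mul P B
  rw [← hG.proj_mul_eq hg hDp hP hPD hs (by rw [proj_mul_smul_add_one_sub_mul hP]; simp)]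
  exact proj_mul_le_of_le hP (hG.commute _ _ hDp hP hPD) (hG.commute _ _ hB hP hPB)
    (hG.mono _ _ hDp hB hDB)

theorem IsLocalMonotone.proj_mul_le (hG : IsLocalMonotone G) (hg : HasSymbol G g)
    {B P : H →L[ℂ] H} (hB : IsStrictlyPositive B) (hP : IsStarProjection P) (hPB : Commute P B)
    {s : ℝ} (hs : 0 < s) (h : P * B ≤ s • P) : P * G B ≤ g s • P := by
  set D := s • P + (1 - P) * B with hD
  have hDp : IsStrictlyPositive D := isStrictlyPositive_smul_add_one_sub_mul hP hPB hB hs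
  have hPD : Commute P D := commute_smul_add_one_sub_mul hPB s
  have hDB : B ≤ D := by
    calc B = P * B + (1 - P) * B := (proj_mul_add_one_sub_mul P B).symm
      _ ≤ D := add_le_add_left h _
  rw [← hG.proj_mul_eq hg hDp hP hPD hs (by rw [proj_mul_smul_add_one_sub_mul hP]; simp)]
  exact proj_mul_le_of_le hP (hG.commute _ _ hB hP hPB) (hG.commute _ _ hDp hP hPD)
    (hG.mono _ _ hB hDp hDB)

/-- Local monotone maps are compared through their values at scalars. -/
theorem IsLocalMonotone.le_of_symbol_le (hG₁ : IsLocalMonotone G₁) (hg₁ : HasSymbol G₁ g₁)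
    (hG₂ : IsLocalMonotone G₂) (hg₂ : HasSymbol G₂ g₂) {k K : ℝ} (hk : 0 < k) (hkK : k ≤ K)
    (hle : ∀ t ∈ Set.Icc k K, g₁ t ≤ g₂ t) (hcont : ContinuousOn g₂ (Set.Icc k K))
    {B : H →L[ℂ] H} (hkB : k • 1 ≤ B) (hBK : B ≤ K • 1) : G₁ B ≤ G₂ B := by
  have hB := isStrictlyPositive_of_smul_one_le hk hkB
  suffices hε : ∀ ε : ℝ, 0 < ε → G₁ B ≤ G₂ B + ε • 1 by
    have hlim : Tendsto (fun ε : ℝ => G₂ B + ε • (1 : H →L[ℂ] H)) (𝓝[>] 0) (𝓝 (G₂ B)) := by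
      have : Tendsto (fun ε : ℝ => G₂ B + ε • (1 : H →L[ℂ] H)) (𝓝 0)
          (𝓝 (G₂ B + (0 : ℝ) • (1 : H →L[ℂ] H))) :=
        ((continuous_id.smul continuous_const).const_add (G₂ B)).tendsto 0
      rw [zero_smul, add_zero] at this
      exact this.mono_left nhdsWithin_le_nhds
    exact ge_of_tendsto hlim (eventually_mem_nhdsWithin.mono fun ε hε' => hε ε hε')
  intro ε hε
  obtain ⟨δ, hδ, huc⟩ := Metric.uniformContinuousOn_iff.1
    (isCompact_Icc.uniformContinuousOn_of_continuous hcont) ε hε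
  obtain ⟨N, hN⟩ := exists_nat_gt ((K - k) / δ)
  have hN0 : (0 : ℝ) < N := (div_nonneg (sub_nonneg.2 hkK) hδ.le).trans_lt hN
  -- [k, K] is cut into N pieces on each of which g₂ varies by less than ε.
  have hmesh : (K - k) / N < δ := by rwa [div_lt_comm₀ hN0 hδ]
  have hd : 0 ≤ (K - k) / N := div_nonneg (sub_nonneg.2 hkK) hN0.le
  set t : ℕ → ℝ := fun i => k + i * ((K - k) / N) with ht
  have htk : ∀ i, k ≤ t i := fun i => le_add_of_nonneg_right (by positivity)
  have ht0 : ∀ i, 0 < t i := fun i => hk.trans_le (htk i)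
  have htN : t N = K := by simp only [ht]; field_simp; ring
  have hts : ∀ i, t (i + 1) = t i + (K - k) / N := fun i => by simp only [ht]; push_cast; ring
  have htmono : Monotone t := monotone_nat_of_le_succ fun i => by rw [hts]; linarith
  -- Induction on how much of the spectrum lies under P. The step splits P by the spectral
  -- projection E at t i: P (1 - E) is covered by the hypothesis, and on P E the operator B lies
  -- between t i and t (i + 1). For i = 0 the bound k ≤ B pins P B to k P.
  have claim : ∀ i ≤ N, ∀ P : H →L[ℂ] H, IsStarProjection P → Commute P B →
      P * B ≤ t i • P → P * G₁ B ≤ P * G₂ B + ε • P := by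
    intro i
    induction i with
    | zero =>
      intro _ P hP hPB h
      have h0 : t 0 = k := by simp [ht]
      rw [h0] at h
      have hkP : k • P ≤ P * B := by
        simpa using proj_mul_le_of_le hP ((Commute.one_right P).smul_right k) hPB hkB
      calc P * G₁ B ≤ g₁ k • P := hG₁.proj_mul_le hg₁ hB hP hPB hk h
        _ ≤ g₂ k • P := smul_le_smul_of_nonneg_right (hle k ⟨le_rfl, hkK⟩) hP.nonneg
        _ ≤ P * G₂ B := hG₂.le_proj_mul hg₂ hB hP hPB hk hkP
        _ ≤ _ := le_add_of_nonneg_right (smul_nonneg hε.le hP.nonneg)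
    | succ i ih =>
      intro hi P hP hPB h
      obtain ⟨E, hE, hEc, hE1, hE2⟩ := exists_spectral_projection hB.isSelfAdjoint (t i)
      have hEB : Commute E B := (hEc B hB.isSelfAdjoint (Commute.refl B)).symm
      have hPE : Commute P E := hEc P hP.isSelfAdjoint hPB
      have hPE' : Commute P (1 - E) := (Commute.one_right P).sub_right hPE
      have hEB' : Commute (1 - E) B := (Commute.one_left B).sub_left hEB
      have low := ih (by omega) (P * (1 - E)) (hP.mul hE.one_sub hPE') (hPB.mul_left hEB') (by
        have := proj_mul_le_of_le hP (hPE'.mul_right hPB) (hPE'.smul_right _) hE2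
        rwa [← mul_assoc, mul_smul_comm] at this)
      have hPEp := hP.mul hE hPE
      have hPEB := hPB.mul_left hEB
      have b1 : t i • (P * E) ≤ P * E * B := by
        have := proj_mul_le_of_le hP (hPE.smul_right _) (hPE.mul_right hPB) hE1
        rwa [← mul_assoc, mul_smul_comm] at this
      have b2 : P * E * B ≤ t (i + 1) • (P * E) := by
        have := proj_mul_le_of_le hE (hPE.symm.mul_right hEB) (hPE.symm.smul_right _) h
        rwa [← mul_assoc, mul_smul_comm, ← hPE.eq] at this
      have hi1 : t i ≤ K := htN ▸ htmono (by omega)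
      have hi2 : t (i + 1) ≤ K := htN ▸ htmono hi
      -- On the slice G₁ B is at most g₁ at the right end and G₂ B at least g₂ at the left end;
      -- uniform continuity bridges the two.
      have hg : g₁ (t (i + 1)) ≤ g₂ (t i) + ε := by
        have h1 := hle _ ⟨htk (i + 1), hi2⟩
        have h2 := huc _ ⟨htk (i + 1), hi2⟩ _ ⟨htk i, hi1⟩ (by
          rw [Real.dist_eq, hts, add_sub_cancel_left, abs_of_nonneg hd]; exact hmesh)
        rw [Real.dist_eq] at h2
        linarith [(abs_lt.1 h2).2]
      have high : P * E * G₁ B ≤ P * E * G₂ B + ε • (P * E) := by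
        calc P * E * G₁ B ≤ g₁ (t (i + 1)) • (P * E) :=
              hG₁.proj_mul_le hg₁ hB hPEp hPEB (ht0 _) b2
          _ ≤ (g₂ (t i) + ε) • (P * E) := smul_le_smul_of_nonneg_right hg hPEp.nonneg
          _ = g₂ (t i) • (P * E) + ε • (P * E) := add_smul _ _ _
          _ ≤ _ := add_le_add_left (hG₂.le_proj_mul hg₂ hB hPEp hPEB (ht0 _) b1) _
      have e : P * E + P * (1 - E) = P := by rw [← mul_add, add_sub_cancel, mul_one]
      calc P * G₁ B = P * E * G₁ B + P * (1 - E) * G₁ B := by rw [← add_mul, e]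
        _ ≤ _ := add_le_add high low
        _ = (P * E + P * (1 - E)) * G₂ B + ε • (P * E + P * (1 - E)) := by
          rw [add_mul, smul_add]; abel
        _ = _ := by rw [e]
  have := claim N le_rfl 1 (.one _) (Commute.one_left B) (by rwa [one_mul, htN])
  simpa using this

end LocalMonotone

theorem exists_orthonormal_pair {H : Type*} [NormedAddCommGroup H] [InnerProductSpace ℂ H]
    (hH : 1 < Module.rank ℂ H) :
    ∃ u w : H, ‖u‖ = 1 ∧ ‖w‖ = 1 ∧ inner ℂ u w = 0 := by
  have h1 : ¬ ∃ v₀ : H, ∀ v, ∃ r : ℂ, r • v₀ = v := fun h => hH.not_ge (rank_le_one_iff.2 h)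
  push Not at h1
  obtain ⟨x, hx⟩ := h1 0
  have hx0 : x ≠ 0 := by simpa using (hx 0).symm
  obtain ⟨y, hy⟩ := h1 x
  have hbot : (ℂ ∙ x)ᗮ ≠ ⊥ := fun h => by
    rw [Submodule.orthogonal_eq_bot_iff] at h
    obtain ⟨r, hr⟩ := Submodule.mem_span_singleton.1 (h ▸ Submodule.mem_top : y ∈ ℂ ∙ x)
    exact hy r hr
  obtain ⟨z, hz, hz0⟩ := Submodule.exists_mem_ne_zero_of_ne_bot hbot
  refine ⟨((‖x‖⁻¹ : ℝ) : ℂ) • x, ((‖z‖⁻¹ : ℝ) : ℂ) • z, ?_, ?_, ?_⟩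
  · rw [norm_smul, Complex.norm_real, norm_inv, norm_norm, inv_mul_cancel₀ (norm_ne_zero_iff.2 hx0)]
  · rw [norm_smul, Complex.norm_real, norm_inv, norm_norm, inv_mul_cancel₀ (norm_ne_zero_iff.2 hz0)]
  · rw [inner_smul_left, inner_smul_right, Submodule.mem_orthogonal_singleton_iff_inner_right.1 hz]
    simp

theorem le_of_smul_le_smul_of_nonneg_of_ne_zero {A : Type*} [CStarAlgebra A] [PartialOrder A]
    [StarOrderedRing A] {P : A} (hP : 0 ≤ P) (hP0 : P ≠ 0) {x y : ℝ} (h : x • P ≤ y • P) :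
    x ≤ y := by
  by_contra! hlt
  have h1 : (x - y) • P ≤ 0 := by rw [sub_smul]; exact sub_nonpos.2 h
  have h2 := smul_le_smul_of_nonneg_left h1 (inv_nonneg.2 (sub_pos.2 hlt).le)
  rw [smul_smul, inv_mul_cancel₀ (sub_pos.2 hlt).ne', one_smul, smul_zero] at h2
  exact hP0 (le_antisymm h2 hP)

/-- An operator is dominated by a multiple of its diagonal part with respect to a projection. -/
theorem le_smul_diagonal {A : Type*} [CStarAlgebra A] [PartialOrder A] [StarOrderedRing A]
    {B P : A} (hB : 0 ≤ B) (hP : IsStarProjection P) {δ : ℝ} (hδ : 0 < δ) :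
    B ≤ (1 + δ) • (P * B * P) + (1 + δ⁻¹) • ((1 - P) * B * (1 - P)) := by
  set r := Real.sqrt δ with hr
  have hr0 : 0 < r := Real.sqrt_pos.2 hδ
  have hrr : r * r = δ := Real.mul_self_sqrt hδ.le
  have hrr' : r⁻¹ * r⁻¹ = δ⁻¹ := by rw [← mul_inv, hrr]
  -- Conjugating B by this operator keeps it positive; expanding, the off-diagonal terms are bounded
  -- by δ and δ⁻¹ times the diagonal blocks.
  have hsa : IsSelfAdjoint (r • P - r⁻¹ • (1 - P)) :=
    ((IsSelfAdjoint.all r).smul hP.isSelfAdjoint).sub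
      ((IsSelfAdjoint.all _).smul hP.one_sub.isSelfAdjoint)
  have h := hsa.conjugate_nonneg hB
  have e : (r • P - r⁻¹ • (1 - P)) * B * (r • P - r⁻¹ • (1 - P))
      = δ • (P * B * P) + δ⁻¹ • ((1 - P) * B * (1 - P))
        - (P * B * (1 - P) + (1 - P) * B * P) := by
    generalize 1 - P = Q
    simp only [sub_mul, mul_sub, smul_mul_assoc, mul_smul_comm, smul_sub, smul_smul, hrr,
      hrr', mul_inv_cancel₀ hr0.ne', inv_mul_cancel₀ hr0.ne', one_smul]
    abel
  rw [e, sub_nonneg] at h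
  calc B = (P + (1 - P)) * B * (P + (1 - P)) := by simp
    _ = P * B * P + (1 - P) * B * (1 - P) + (P * B * (1 - P) + (1 - P) * B * P) := by
      rw [add_mul, add_mul, mul_add, mul_add]; abel
    _ ≤ P * B * P + (1 - P) * B * (1 - P) + (δ • (P * B * P) + δ⁻¹ • ((1 - P) * B * (1 - P))) :=
      add_le_add_right h _
    _ = _ := by rw [add_smul, add_smul, one_smul, one_smul]; abel

/-! ### Concavity and strict monotonicity of the symbol in dimension at least two -/

section Symbol

variable {H : Type*} [NormedAddCommGroup H] [InnerProductSpace ℂ H] [CompleteSpace H]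

open InnerProductSpace

theorem rankOne_mul_rankOne_mul_rankOne (u v : H) :
    rankOne ℂ v v * rankOne ℂ u u * rankOne ℂ v v
      = ‖inner ℂ u v‖ ^ 2 • rankOne ℂ v v := by
  ext x
  simp only [mul_apply_eq_comp, rankOne_apply, map_smul, smul_apply]
  rw [← inner_conj_symm v u, smul_smul, smul_smul, ← Complex.coe_smul,
    smul_smul]
  congr 1
  push_cast
  rw [← Complex.conj_mul']
  ring

variable {G : (H →L[ℂ] H) → (H →L[ℂ] H)} {g : ℝ → ℝ}

theorem IsLocalMonotone.apply_smul_add_smul (hG : IsLocalMonotone G) (hg : HasSymbol G g)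
    {P : H →L[ℂ] H} (hP : IsStarProjection P) {a b : ℝ} (ha : 0 < a) (hb : 0 < b) :
    IsStrictlyPositive (a • P + b • (1 - P)) ∧
      G (a • P + b • (1 - P)) = g a • P + g b • (1 - P) := by
  have hPc : Commute P (1 - P) := (Commute.one_right P).sub_right (Commute.refl P)
  have e : a • P + (1 - P) * (b • (1 : H →L[ℂ] H)) = a • P + b • (1 - P) := by simp
  have hB : IsStrictlyPositive (a • P + b • (1 - P)) := by
    rw [← e]
    exact isStrictlyPositive_smul_add_one_sub_mul hP ((Commute.one_right P).smul_right b)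
      (isStrictlyPositive_smul_one hb) ha
  have hc : Commute P (a • P + b • (1 - P)) :=
    ((Commute.refl P).smul_right a).add_right (hPc.smul_right b)
  refine ⟨hB, ?_⟩
  rw [← proj_mul_add_one_sub_mul P (G _), hG.proj_mul_eq hg hB hP hc ha (by
      rw [mul_add, mul_smul_comm, mul_smul_comm, hP.isIdempotentElem.eq, hP.mul_one_sub_self,
        smul_zero, add_zero]),
    hG.proj_mul_eq hg hB hP.one_sub ((Commute.one_left _).sub_left hc) hb (by
      rw [mul_add, mul_smul_comm, mul_smul_comm, hP.one_sub.isIdempotentElem.eq,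
        hP.one_sub_mul_self, smul_zero, zero_add])]

/-- Put B = a P_u + b (1 - P_u). Its quadratic form at v is c = l a + (1 - l) b with l = |⟨u, v⟩|².
As c < y, the diagonal domination with (1 + δ) c = y gives B ≤ y P_v + K (1 - P_v) for all large K;
then apply G to both sides. -/
theorem IsLocalMonotone.rankOne_le (hG : IsLocalMonotone G) (hg : HasSymbol G g)
    {u v : H} (hu : ‖u‖ = 1) (hv : ‖v‖ = 1) {a b y : ℝ} (ha : 0 < a) (hb : 0 < b)
    (hy : ‖inner ℂ u v‖ ^ 2 * a + (1 - ‖inner ℂ u v‖ ^ 2) * b < y) :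
    ∃ K₀ : ℝ, 0 < K₀ ∧ ∀ K, K₀ ≤ K →
      g a • rankOne ℂ u u + g b • (1 - rankOne ℂ u u)
        ≤ g y • rankOne ℂ v v + g K • (1 - rankOne ℂ v v) := by
  have hPu := isStarProjection_rankOne_self (𝕜 := ℂ) hu
  have hPv := isStarProjection_rankOne_self (𝕜 := ℂ) hv
  have huv : ‖inner ℂ u v‖ ^ 2 ≤ 1 := by
    have := norm_inner_le_norm (𝕜 := ℂ) u v
    rw [hu, hv, one_mul] at this
    exact pow_le_one₀ (norm_nonneg _) this
  have hconj := rankOne_mul_rankOne_mul_rankOne u v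
  set l := ‖inner ℂ u v‖ ^ 2 with hl
  have hl0 : 0 ≤ l := by positivity
  set P := rankOne ℂ u u
  set Q := rankOne ℂ v v
  obtain ⟨hBp, hGB⟩ := hG.apply_smul_add_smul hg hPu ha hb
  set c := l * a + (1 - l) * b with hc
  have hc0 : 0 < c := by
    rcases hl0.eq_or_lt with h | h
    · rw [hc, ← h]; linarith
    · exact add_pos_of_pos_of_nonneg (mul_pos h ha) (mul_nonneg (by linarith) hb.le)
  have hy0 : 0 < y := hc0.trans hy
  have hδ : 0 < (y - c) / c := div_pos (sub_pos.2 hy) hc0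
  set δ := (y - c) / c with hδdef
  have hδc : (1 + δ) * c = y := by rw [hδdef]; field_simp; ring
  have hmax : 0 < max a b := lt_max_of_lt_left ha
  refine ⟨(1 + δ⁻¹) * max a b, by positivity, fun K hK => ?_⟩
  have hK0 : 0 < K := lt_of_lt_of_le (by positivity) hK
  obtain ⟨hDp, hGD⟩ := hG.apply_smul_add_smul hg hPv hy0 hK0
  rw [← hGB, ← hGD]
  refine hG.mono _ _ hBp hDp ((le_smul_diagonal hBp.nonneg hPv hδ).trans (add_le_add ?_ ?_))
  · have e : Q * (a • P + b • (1 - P)) * Q = c • Q := by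
      rw [mul_add, mul_smul_comm, mul_smul_comm, add_mul, smul_mul_assoc, smul_mul_assoc, mul_sub,
        sub_mul, mul_one, hPv.isIdempotentElem.eq, hconj, smul_sub, smul_smul, smul_smul, hc]
      module
    rw [e, smul_smul, hδc]
  · have hBm : a • P + b • (1 - P) ≤ max a b • (1 : H →L[ℂ] H) := by
      calc _ ≤ max a b • P + max a b • (1 - P) :=
            add_le_add (smul_le_smul_of_nonneg_right (le_max_left _ _) hPu.nonneg)
              (smul_le_smul_of_nonneg_right (le_max_right _ _) hPu.one_sub.nonneg)
        _ = _ := by rw [← smul_add, add_sub_cancel]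
    have h1 := hPv.one_sub.isSelfAdjoint.conjugate_le_conjugate hBm
    rw [mul_smul_comm, mul_one, smul_mul_assoc, hPv.one_sub.isIdempotentElem.eq] at h1
    have h2 := smul_le_smul_of_nonneg_left h1 (show 0 ≤ 1 + δ⁻¹ by positivity)
    rw [smul_smul] at h2
    exact h2.trans (smul_le_smul_of_nonneg_right hK hPv.one_sub.nonneg)

theorem exists_unit_vector_inner_eq {u w : H} (hu : ‖u‖ = 1) (hw : ‖w‖ = 1)
    (huw : inner ℂ u w = 0) {l : ℝ} (hl : l ∈ Set.Icc (0 : ℝ) 1) :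
    ∃ v : H, ‖v‖ = 1 ∧ ‖inner ℂ u v‖ ^ 2 = l ∧ ‖inner ℂ v w‖ ^ 2 = 1 - l := by
  have h1 : 0 ≤ 1 - l := sub_nonneg.2 hl.2
  refine ⟨((Real.sqrt l : ℝ) : ℂ) • u + ((Real.sqrt (1 - l) : ℝ) : ℂ) • w, ?_, ?_, ?_⟩
  · have := norm_add_sq_eq_norm_sq_add_norm_sq_of_inner_eq_zero
      (((Real.sqrt l : ℝ) : ℂ) • u) (((Real.sqrt (1 - l) : ℝ) : ℂ) • w)
      (by rw [inner_smul_left, inner_smul_right, huw]; simp)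
    rw [norm_smul, norm_smul, hu, hw, Complex.norm_real, Complex.norm_real, mul_one, mul_one,
      Real.norm_of_nonneg (Real.sqrt_nonneg _), Real.norm_of_nonneg (Real.sqrt_nonneg _),
      Real.mul_self_sqrt hl.1, Real.mul_self_sqrt h1, add_sub_cancel] at this
    nlinarith [norm_nonneg (((Real.sqrt l : ℝ) : ℂ) • u + ((Real.sqrt (1 - l) : ℝ) : ℂ) • w)]
  · rw [inner_add_right, inner_smul_right, inner_smul_right, huw, inner_self_eq_norm_sq_to_K, hu]
    simp [Real.sq_sqrt hl.1]
  · rw [inner_add_left, inner_smul_left, inner_smul_left, huw, inner_self_eq_norm_sq_to_K, hw]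
    simp [Real.sq_sqrt h1]

theorem rankOne_self_ne_zero {v : H} (hv : ‖v‖ = 1) : rankOne ℂ v v ≠ 0 := by
  have : v ≠ 0 := fun h => by simp [h] at hv
  exact rankOne_ne_zero this this

theorem IsLocalMonotone.monotoneOn_symbol (hH : 1 < Module.rank ℂ H) (hG : IsLocalMonotone G)
    (hg : HasSymbol G g) : MonotoneOn g (Set.Ioi 0) := by
  intro s hs t ht hst
  obtain ⟨u, -, hu, -⟩ := exists_orthonormal_pair hH
  have hne : (1 : H →L[ℂ] H) ≠ 0 := fun h => by
    have := congr($h u)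
    simp only [one_apply_eq_self, zero_apply] at this
    simp [this] at hu
  have := hG.mono _ _ (isStrictlyPositive_smul_one hs) (isStrictlyPositive_smul_one ht)
    (smul_one_le_smul_one hst)
  rw [hg s hs, hg t ht] at this
  exact le_of_smul_le_smul_of_nonneg_of_ne_zero zero_le_one hne this

/-- Compressing `IsLocalMonotone.rankOne_le` to v removes the term with K. This is concavity up to
the strict inequality on y. -/
theorem IsLocalMonotone.convex_comb_symbol_le (hH : 1 < Module.rank ℂ H) (hG : IsLocalMonotone G)
    (hg : HasSymbol G g) {a b l y : ℝ} (ha : 0 < a) (hb : 0 < b) (hl : l ∈ Set.Icc (0 : ℝ) 1)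
    (hy : l * a + (1 - l) * b < y) : l * g a + (1 - l) * g b ≤ g y := by
  obtain ⟨u, w, hu, hw, huw⟩ := exists_orthonormal_pair hH
  obtain ⟨v, hv, huv, -⟩ := exists_unit_vector_inner_eq hu hw huw hl
  obtain ⟨K, -, hK⟩ := hG.rankOne_le hg hu hv ha hb (y := y) (by rwa [huv])
  have hPv := isStarProjection_rankOne_self (𝕜 := ℂ) hv
  have hconj := rankOne_mul_rankOne_mul_rankOne u v
  rw [huv] at hconj
  have h := hPv.isSelfAdjoint.conjugate_le_conjugate (hK K le_rfl)
  have h0 := rankOne_self_ne_zero hv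
  set P := rankOne ℂ u u
  set Q := rankOne ℂ v v
  have e1 : Q * (g a • P + g b • (1 - P)) * Q = (l * g a + (1 - l) * g b) • Q := by
    rw [mul_add, mul_smul_comm, mul_smul_comm, add_mul, smul_mul_assoc, smul_mul_assoc, mul_sub,
      sub_mul, mul_one, hPv.isIdempotentElem.eq, hconj, smul_sub, smul_smul, smul_smul]
    module
  have e2 : Q * (g y • Q + g K • (1 - Q)) * Q = g y • Q := by
    rw [mul_add, mul_smul_comm, mul_smul_comm, hPv.isIdempotentElem.eq, hPv.mul_one_sub_self,
      smul_zero, add_zero, smul_mul_assoc, hPv.isIdempotentElem.eq]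
  rw [e1, e2] at h
  exact le_of_smul_le_smul_of_nonneg_of_ne_zero hPv.nonneg h0 h

/-- On a space of dimension at least two the symbol is concave. -/
theorem IsLocalMonotone.concaveOn_symbol (hH : 1 < Module.rank ℂ H) (hG : IsLocalMonotone G)
    (hg : HasSymbol G g) (hg0 : ∀ t, 0 < t → 0 ≤ g t) : ConcaveOn ℝ (Set.Ioi 0) g := by
  refine ⟨convex_Ioi 0, fun a (ha : 0 < a) b (hb : 0 < b) l l' hl hl' hll => ?_⟩
  obtain rfl : l' = 1 - l := by linarith
  have hlI : l ∈ Set.Icc (0 : ℝ) 1 := ⟨hl, by linarith⟩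
  simp only [smul_eq_mul]
  set c := l * a + (1 - l) * b with hc
  have hc0 : 0 < c := by
    rcases hl.eq_or_lt with h | h
    · rw [hc, ← h]; linarith
    · exact add_pos_of_pos_of_nonneg (mul_pos h ha) (mul_nonneg hl' hb.le)
  by_contra! hlt
  set S := l * g a + (1 - l) * g b
  have hgc := hg0 c hc0
  have hS : 0 < S := hgc.trans_lt hlt
  -- If S > g(c), then S ≤ g(c + μc/4). The mean of c/2 and c + μc/4 with weights μ and 1 - μ is
  -- still below c, so (1 - μ) S ≤ g(c), using g ≥ 0. But (1 - μ) S = (S + g(c))/2 > g(c).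
  set μ := (S - g c) / (2 * S) with hμ
  have hμ0 : 0 < μ := div_pos (sub_pos.2 hlt) (by positivity)
  have hμ1 : μ ≤ 1 := by rw [hμ, div_le_one (by positivity)]; linarith
  have h1 : S ≤ g (c + μ * c / 4) := hG.convex_comb_symbol_le hH hg ha hb hlI (by
    have : 0 < μ * c / 4 := by positivity
    linarith)
  have h2 := hG.convex_comb_symbol_le hH hg (half_pos hc0)
    (show 0 < c + μ * c / 4 by positivity) (y := c) ⟨hμ0.le, hμ1⟩ (by
      have : 0 < μ * c := by positivity
      have : 0 < μ * (μ * c) := by positivity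
      nlinarith)
  have h3 := mul_nonneg hμ0.le (hg0 _ (half_pos hc0))
  have h4 := mul_le_mul_of_nonneg_left h1 (sub_nonneg.2 hμ1)
  have h5 : (1 - μ) * S = S - (S - g c) / 2 := by rw [hμ]; field_simp
  linarith

/-- A nonconstant symbol is strictly increasing. -/
theorem IsLocalMonotone.symbol_lt (hH : 1 < Module.rank ℂ H) (hG : IsLocalMonotone G)
    (hg : HasSymbol G g) (hg0 : ∀ t, 0 < t → 0 ≤ g t)
    (hconst : ¬ ∃ c, ∀ t, 0 < t → g t = c) {s t : ℝ} (hs : 0 < s) (hst : s < t) : g s < g t := by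
  have hmono := hG.monotoneOn_symbol hH hg
  have hconc := hG.concaveOn_symbol hH hg hg0
  have ht : 0 < t := hs.trans hst
  by_contra! hle
  have hst' : g s = g t := le_antisymm (hmono hs ht hst.le) hle
  -- A concave monotone function that is flat between s and t stays flat to the right.
  have htail : ∀ K, s ≤ K → g K = g s := fun K hK => by
    have hK0 : 0 < K := hs.trans_le hK
    refine le_antisymm ?_ (hmono hs hK0 hK)
    rcases le_or_gt K t with h | h
    · rw [hst']; exact hmono hK0 ht h
    · have h1 := hconc.slope_anti_adjacent (x := s) (y := t) (z := K) hs hK0 hst h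
      rw [hst', sub_self, zero_div, div_le_iff₀ (sub_pos.2 h), zero_mul] at h1
      linarith
  obtain ⟨y, hy0, hy⟩ : ∃ y, 0 < y ∧ g y ≠ g s := by
    by_contra! h
    exact hconst ⟨g s, h⟩
  have hys : y < s := by
    by_contra! h
    exact hy (htail y h)
  have hgy : g y < g s := lt_of_le_of_ne (hmono hy0 hs hys.le) hy
  -- Concavity alone does not exclude a shape such as min(t, 1); a second rank-one test does. With v
  -- almost parallel to u, the form of (y/2) P_u + s (1 - P_u) at v is below y. Compressing to w ⟂ u
  -- gives g(s) ≤ μ g(y) + (1 - μ) g(s), impossible for g(y) < g(s).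
  set μ := y / (4 * s) with hμ
  have hμ0 : 0 < μ := by positivity
  have hμ1 : μ ≤ 1 := by rw [hμ, div_le_one (by positivity)]; linarith
  have hμs : μ * s = y / 4 := by rw [hμ]; field_simp
  obtain ⟨u, w, hu, hw, huw⟩ := exists_orthonormal_pair hH
  obtain ⟨v, hv, huv, hvw⟩ := exists_unit_vector_inner_eq hu hw huw
    (l := 1 - μ) ⟨by linarith, by linarith⟩
  obtain ⟨K₀, -, hK⟩ := hG.rankOne_le hg hu hv (half_pos hy0) hs (y := y) (by
    rw [huv, sub_sub_cancel, hμs]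
    nlinarith [mul_pos hμ0 hy0])
  have hPu := isStarProjection_rankOne_self (𝕜 := ℂ) hu
  have hPw := isStarProjection_rankOne_self (𝕜 := ℂ) hw
  have h := hPw.isSelfAdjoint.conjugate_le_conjugate (hK (max K₀ s) (le_max_left _ _))
  have h0 := rankOne_self_ne_zero hw
  rw [htail _ (le_max_right _ _)] at h
  have c1 := rankOne_mul_rankOne_mul_rankOne u w
  have c2 := rankOne_mul_rankOne_mul_rankOne v w
  rw [huw, norm_zero, zero_pow two_ne_zero, zero_smul] at c1
  rw [hvw, sub_sub_cancel] at c2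
  set P := rankOne ℂ u u
  set Q := rankOne ℂ v v
  set R := rankOne ℂ w w
  have e1 : R * (g (y / 2) • P + g s • (1 - P)) * R = g s • R := by
    rw [mul_add, mul_smul_comm, mul_smul_comm, add_mul, smul_mul_assoc, smul_mul_assoc, mul_sub,
      sub_mul, mul_one, hPw.isIdempotentElem.eq, c1]
    simp
  have e2 : R * (g y • Q + g s • (1 - Q)) * R = (g y * μ + g s * (1 - μ)) • R := by
    rw [mul_add, mul_smul_comm, mul_smul_comm, add_mul, smul_mul_assoc, smul_mul_assoc, mul_sub,
      sub_mul, mul_one, hPw.isIdempotentElem.eq, c2]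
    module
  rw [e1, e2] at h
  have := le_of_smul_le_smul_of_nonneg_of_ne_zero hPw.nonneg h0 h
  nlinarith

end Symbol

/-! ### Scalar consequences of concavity -/

theorem ConcaveOn.exists_affine_majorant {g : ℝ → ℝ} (hg : ConcaveOn ℝ (Set.Ioi 0) g)
    (h1 : g 1 = 1) (h12 : g 1 < g 2) :
    ∃ α : ℝ, 0 < α ∧ ∀ t, 0 < t → g t ≤ (1 - α) + α * t := by
  -- The infimum of the secant slopes to the left of 1 is the slope of a supporting line; it
  -- dominates every slope to the right, in particular g 2 - g 1 > 0.
  set S : Set ℝ := (fun x => (g 1 - g x) / (1 - x)) '' Set.Ioo 0 1 with hS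
  have hlow : ∀ y, 1 < y → ∀ z ∈ S, (g y - g 1) / (y - 1) ≤ z := by
    rintro y hy _ ⟨x, hx, rfl⟩
    exact hg.slope_anti_adjacent (x := x) (y := 1) (z := y) hx.1 (one_pos.trans hy) hx.2 hy
  have hne : S.Nonempty := ⟨_, 1 / 2, ⟨by norm_num, by norm_num⟩, rfl⟩
  have hbdd : BddBelow S := ⟨_, fun z hz => hlow 2 one_lt_two z hz⟩
  refine ⟨sInf S, ?_, fun t ht => ?_⟩
  · have := le_csInf hne (hlow 2 one_lt_two)
    have h3 : (g 2 - g 1) / (2 - 1) = g 2 - g 1 := by norm_num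
    rw [h3] at this
    linarith
  · rcases lt_trichotomy t 1 with h | rfl | h
    · have := csInf_le hbdd ⟨t, ⟨ht, h⟩, rfl⟩
      rw [le_div_iff₀ (sub_pos.2 h)] at this
      linarith
    · linarith
    · have := le_csInf hne (hlow t h)
      rw [div_le_iff₀ (sub_pos.2 h)] at this
      linarith

theorem ConcaveOn.exists_contraction {g : ℝ → ℝ} (hg : ConcaveOn ℝ (Set.Ioi 0) g)
    (hmono : MonotoneOn g (Set.Ioi 0)) {κ : ℝ} (hκ : 0 < κ) (hpos : 0 < g κ)
    (hlt : g κ < g (2 * κ)) :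
    ∃ θ : ℝ, 0 < θ ∧ θ < 1 ∧ ∀ t ∈ Set.Icc κ⁻¹ κ, ∀ c : ℝ, 0 < c → c ≤ 1 →
      g (c * t) ≤ (1 - θ * (1 - c)) * g t := by
  -- By concavity s bounds from below every secant slope with right end t ≤ κ, so g(t) - g(c t) ≥ s
  -- (1 - c) t. The choice of θ makes θ g(t) ≤ s t on [κ⁻¹, κ]; the cap 1/2 only ensures θ < 1.
  set s := (g (2 * κ) - g κ) / (2 * κ) with hs
  have hs0 : 0 < s := div_pos (sub_pos.2 hlt) (by positivity)
  refine ⟨min (s / (κ * g κ)) (1 / 2), by positivity, by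
    linarith [min_le_right (s / (κ * g κ)) (1 / 2)], fun t ht c hc0 hc1 => ?_⟩
  have ht0 : 0 < t := (inv_pos.2 hκ).trans_le ht.1
  rcases hc1.eq_or_lt with rfl | hc1
  · simp
  have hct : c * t < t := by nlinarith
  have hgt : g t ≤ g κ := hmono ht0 hκ ht.2
  have hct0 : 0 < c * t := mul_pos hc0 ht0
  have h1 := hg.slope_anti_adjacent (x := c * t) (y := t) (z := 2 * κ) hct0
    (show 0 < 2 * κ by positivity) hct (by linarith [ht.2])
  have h2 : s ≤ (g (2 * κ) - g t) / (2 * κ - t) := by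
    refine div_le_div₀ (by linarith) (by linarith) (by linarith [ht.2]) (by linarith)
  have h3 := h2.trans h1
  rw [le_div_iff₀ (sub_pos.2 hct)] at h3
  have hθ : min (s / (κ * g κ)) (1 / 2) * g t ≤ s * t := by
    rcases le_or_gt (g t) 0 with h | h
    · have h4 : 0 ≤ min (s / (κ * g κ)) (1 / 2) := by positivity
      have h5 : 0 ≤ s * t := by positivity
      nlinarith
    · calc min (s / (κ * g κ)) (1 / 2) * g t ≤ s / (κ * g κ) * g κ :=
            mul_le_mul (min_le_left _ _) hgt h.le (by positivity)
        _ = s * κ⁻¹ := by field_simp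
        _ ≤ s * t := mul_le_mul_of_nonneg_left ht.1 hs0.le
  have h6 := mul_le_mul_of_nonneg_right hθ (sub_nonneg.2 hc1.le)
  linarith

theorem ringInverse_eq_of_mul_eq_one {R : Type*} [MonoidWithZero R] {a b : R} (h : a * b = 1)
    (h' : b * a = 1) : Ring.inverse a = b :=
  Ring.inverse_unit (⟨a, b, h, h'⟩ : Rˣ)

theorem ringInverse_smul_one {A : Type*} [Ring A] [Algebra ℝ A] {c : ℝ} (hc : c ≠ 0) :
    Ring.inverse (c • (1 : A)) = c⁻¹ • (1 : A) :=
  ringInverse_eq_of_mul_eq_one (by simp [smul_smul, hc]) (by simp [smul_smul, hc])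

theorem commute_ringInverse {R : Type*} [MonoidWithZero R] {P B : R} (hB : IsUnit B)
    (h : Commute P B) : Commute P (Ring.inverse B) := by
  obtain ⟨u, rfl⟩ := hB
  rw [Ring.inverse_unit]
  exact h.units_inv_right

/-! ### Operations on local monotone maps, and operator versions of the scalar bounds -/

section LocalMonotone

variable {H : Type*} [NormedAddCommGroup H] [InnerProductSpace ℂ H] [CompleteSpace H]
  {G : (H →L[ℂ] H) → (H →L[ℂ] H)} {g : ℝ → ℝ}

theorem isLocalMonotone_affine {α : ℝ} (hα : 0 ≤ α) (β : ℝ) :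
    IsLocalMonotone (fun B : H →L[ℂ] H => β • (1 : H →L[ℂ] H) + α • B) where
  selfAdjoint B hB := ((IsSelfAdjoint.all β).smul (.one _)).add
    ((IsSelfAdjoint.all α).smul hB.isSelfAdjoint)
  mono B D _ _ h := add_le_add_right (smul_le_smul_of_nonneg_left h hα) _
  commute B P _ _ h := ((Commute.one_right P).smul_right β).add_right (h.smul_right α)
  locality B D P _ _ _ _ _ h := by simp only [mul_add, mul_smul_comm, h]

theorem hasSymbol_affine (α β : ℝ) :
    HasSymbol (fun B : H →L[ℂ] H => β • (1 : H →L[ℂ] H) + α • B) (fun t => β + α * t) :=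
  fun t _ => by simp only [add_smul, mul_smul]

theorem IsLocalMonotone.const_smul (hG : IsLocalMonotone G) {c : ℝ} (hc : 0 ≤ c) :
    IsLocalMonotone (fun B => c • G B) where
  selfAdjoint B hB := (IsSelfAdjoint.all c).smul (hG.selfAdjoint B hB)
  mono B D hB hD h := smul_le_smul_of_nonneg_left (hG.mono B D hB hD h) hc
  commute B P hB hP h := (hG.commute B P hB hP h).smul_right c
  locality B D P hB hD hP hPB hPD h := by
    simp only [mul_smul_comm, hG.locality B D P hB hD hP hPB hPD h]

theorem HasSymbol.const_smul (hg : HasSymbol G g) (c : ℝ) :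
    HasSymbol (fun B => c • G B) (fun t => c * g t) :=
  fun t ht => by simp only [hg t ht, mul_smul]

theorem IsLocalMonotone.comp_smul (hG : IsLocalMonotone G) {c : ℝ} (hc : 0 < c) :
    IsLocalMonotone (fun B => G (c • B)) where
  selfAdjoint B hB := hG.selfAdjoint _ (hB.smul hc)
  mono B D hB hD h := hG.mono _ _ (hB.smul hc) (hD.smul hc) (smul_le_smul_of_nonneg_left h hc.le)
  commute B P hB hP h := hG.commute _ P (hB.smul hc) hP (h.smul_right c)
  locality B D P hB hD hP hPB hPD h :=
    hG.locality _ _ P (hB.smul hc) (hD.smul hc) hP (hPB.smul_right c) (hPD.smul_right c)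
      (by simp only [mul_smul_comm, h])

theorem HasSymbol.comp_smul (hg : HasSymbol G g) {c : ℝ} (hc : 0 < c) :
    HasSymbol (fun B => G (c • B)) (fun t => g (c * t)) :=
  fun t ht => by simp only [smul_smul, hg _ (mul_pos hc ht)]

theorem proj_mul_ringInverse_eq {R : Type*} [MonoidWithZero R] {P B D : R} (hB : IsUnit B)
    (hD : IsUnit D) (hPB : Commute P B) (h : P * B = P * D) :
    P * Ring.inverse B = P * Ring.inverse D := by
  calc P * Ring.inverse B = Ring.inverse B * (P * D) * Ring.inverse D := by
        rw [mul_assoc, mul_assoc, Ring.mul_inverse_cancel D hD, mul_one,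
          (commute_ringInverse hB hPB).eq]
    _ = Ring.inverse B * (B * P) * Ring.inverse D := by rw [← h, hPB.eq]
    _ = _ := by rw [← mul_assoc, Ring.inverse_mul_cancel B hB, one_mul]

/-- The adjoint map `B ↦ G(B⁻¹)⁻¹`. -/
theorem IsLocalMonotone.adjoint (hG : IsLocalMonotone G)
    (hpos : ∀ B, IsStrictlyPositive B → IsStrictlyPositive (G B)) :
    IsLocalMonotone (fun B => Ring.inverse (G (Ring.inverse B))) where
  selfAdjoint _ hB := (hpos _ hB.ringInverse).ringInverse.isSelfAdjoint
  mono _ _ hB hD h := CStarAlgebra.ringInverse_le_ringInverse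
    (hG.mono _ _ hD.ringInverse hB.ringInverse (CStarAlgebra.ringInverse_le_ringInverse h hB))
    (hpos _ hD.ringInverse)
  commute _ P hB hP h := commute_ringInverse (hpos _ hB.ringInverse).isUnit
    (hG.commute _ P hB.ringInverse hP (commute_ringInverse hB.isUnit h))
  locality _ _ P hB hD hP hPB hPD h :=
    have hPB' := commute_ringInverse hB.isUnit hPB
    proj_mul_ringInverse_eq (hpos _ hB.ringInverse).isUnit (hpos _ hD.ringInverse).isUnit
      (hG.commute _ P hB.ringInverse hP hPB')
      (hG.locality _ _ P hB.ringInverse hD.ringInverse hP hPB' (commute_ringInverse hD.isUnit hPD)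
        (proj_mul_ringInverse_eq hB.isUnit hD.isUnit hPB h))

theorem HasSymbol.adjoint (hg : HasSymbol G g) (hg0 : ∀ t, 0 < t → 0 < g t) :
    HasSymbol (fun B => Ring.inverse (G (Ring.inverse B))) (fun t => (g t⁻¹)⁻¹) :=
  fun t ht => by
    simp only [ringInverse_smul_one ht.ne', hg _ (inv_pos.2 ht),
      ringInverse_smul_one (hg0 _ (inv_pos.2 ht)).ne']

theorem exists_mem_Icc_smul_one {B : H →L[ℂ] H} (hB : IsStrictlyPositive B) :
    ∃ k K : ℝ, 0 < k ∧ k ≤ K ∧ k • 1 ≤ B ∧ B ≤ K • 1 := by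
  obtain ⟨k, hk, hkB⟩ := exists_smul_one_le hB
  exact ⟨k, max k ‖B‖, hk, le_max_left _ _, hkB, (le_norm_smul_one hB.isSelfAdjoint).trans
    (smul_one_le_smul_one (le_max_right _ _))⟩

theorem IsLocalMonotone.exists_le_affine (hH : 1 < Module.rank ℂ H) (hG : IsLocalMonotone G)
    (hg : HasSymbol G g) (hg0 : ∀ t, 0 < t → 0 ≤ g t) (hg1 : g 1 = 1)
    (hconst : ¬ ∃ c, ∀ t, 0 < t → g t = c) :
    ∃ α : ℝ, 0 < α ∧ ∀ B : H →L[ℂ] H, IsStrictlyPositive B →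
      G B ≤ (1 - α) • (1 : H →L[ℂ] H) + α • B := by
  obtain ⟨α, hα, h⟩ := (hG.concaveOn_symbol hH hg hg0).exists_affine_majorant hg1
    (hG.symbol_lt hH hg hg0 hconst one_pos one_lt_two)
  refine ⟨α, hα, fun B hB => ?_⟩
  obtain ⟨k, K, hk, hkK, hkB, hBK⟩ := exists_mem_Icc_smul_one hB
  exact hG.le_of_symbol_le hg (isLocalMonotone_affine hα.le (1 - α)) (hasSymbol_affine α (1 - α))
    hk hkK (fun t ht => h t (hk.trans_le ht.1)) (by fun_prop) hkB hBK

theorem IsLocalMonotone.exists_contraction (hH : 1 < Module.rank ℂ H) (hG : IsLocalMonotone G)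
    (hg : HasSymbol G g) (hg0 : ∀ t, 0 < t → 0 < g t)
    (hconst : ¬ ∃ c, ∀ t, 0 < t → g t = c) {κ : ℝ} (hκ : 1 ≤ κ) :
    ∃ θ : ℝ, 0 < θ ∧ θ < 1 ∧ ∀ B : H →L[ℂ] H, κ⁻¹ • 1 ≤ B → B ≤ κ • 1 →
      ∀ c : ℝ, 0 < c → c ≤ 1 → G (c • B) ≤ (1 - θ * (1 - c)) • G B := by
  have hκ0 : 0 < κ := one_pos.trans_le hκ
  have hg0' := fun t ht => (hg0 t ht).le
  have hconc := hG.concaveOn_symbol hH hg hg0'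
  obtain ⟨θ, hθ0, hθ1, h⟩ := hconc.exists_contraction (hG.monotoneOn_symbol hH hg) hκ0
    (hg0 κ hκ0) (hG.symbol_lt hH hg hg0' hconst hκ0 (by linarith))
  refine ⟨θ, hθ0, hθ1, fun B hB1 hB2 c hc0 hc1 => ?_⟩
  have hfac : 0 ≤ 1 - θ * (1 - c) := by nlinarith
  have hsub : Set.Icc κ⁻¹ κ ⊆ Set.Ioi 0 := fun t ht => (inv_pos.2 hκ0).trans_le ht.1
  exact (hG.comp_smul hc0).le_of_symbol_le (hg.comp_smul hc0) (hG.const_smul hfac)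
    (hg.const_smul _) (inv_pos.2 hκ0) ((inv_le_one_of_one_le₀ hκ).trans hκ)
    (fun t ht => h t ht c hc0 hc1)
    (((hconc.continuousOn isOpen_Ioi).mono hsub).const_mul _) hB1 hB2

end LocalMonotone

/-! ### Two-variable operator means -/

section OperatorMean

variable {H : Type*} [NormedAddCommGroup H] [InnerProductSpace ℂ H] [CompleteSpace H]
  {σ : (H →L[ℂ] H) → (H →L[ℂ] H) → (H →L[ℂ] H)}

/-- The transformer inequality for C⁻¹, conjugated back by C, is the reverse of the one for C. -/
theorem IsOperatorMean.congruence (hσ : IsOperatorMean σ) {A B C : H →L[ℂ] H} (hA : 0 ≤ A)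
    (hB : 0 ≤ B) (hC : IsStrictlyPositive C) :
    σ (C * A * C) (C * B * C) = C * σ A B * C := by
  refine le_antisymm ?_ (hσ.transformer A B C hA hB hC.nonneg)
  have hD := hC.ringInverse
  have h1 := Ring.mul_inverse_cancel C hC.isUnit
  have h2 := Ring.inverse_mul_cancel C hC.isUnit
  set D := Ring.inverse C
  have e : ∀ X : H →L[ℂ] H, D * (C * X * C) * D = X := fun X => by
    rw [mul_assoc C, ← mul_assoc D, h2, one_mul, mul_assoc, h1, mul_one]
  have e' : ∀ X : H →L[ℂ] H, C * (D * X * D) * C = X := fun X => by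
    rw [mul_assoc D, ← mul_assoc C, h1, one_mul, mul_assoc, h2, mul_one]
  have h := hσ.transformer _ _ D (hC.isSelfAdjoint.conjugate_nonneg hA)
    (hC.isSelfAdjoint.conjugate_nonneg hB) hD.nonneg
  rw [e, e] at h
  simpa only [e'] using hC.isSelfAdjoint.conjugate_le_conjugate h

theorem sqrt_smul_one_conj {c : ℝ} (hc : 0 < c) (X : H →L[ℂ] H) :
    (Real.sqrt c • (1 : H →L[ℂ] H)) * X * (Real.sqrt c • (1 : H →L[ℂ] H)) = c • X := by
  rw [smul_mul_assoc, one_mul, smul_mul_assoc, mul_smul_comm, mul_one, smul_smul,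
    Real.mul_self_sqrt hc.le]

theorem IsOperatorMean.map_smul_smul (hσ : IsOperatorMean σ) {A B : H →L[ℂ] H} (hA : 0 ≤ A)
    (hB : 0 ≤ B) {c : ℝ} (hc : 0 < c) : σ (c • A) (c • B) = c • σ A B := by
  have := hσ.congruence hA hB (isStrictlyPositive_smul_one (H := H) (Real.sqrt_pos.2 hc))
  simpa only [sqrt_smul_one_conj hc] using this

theorem IsOperatorMean.smul_one_smul_one (hσ : IsOperatorMean σ) {c : ℝ} (hc : 0 < c) :
    σ (c • 1) (c • 1) = c • 1 := by
  rw [hσ.map_smul_smul zero_le_one zero_le_one hc, hσ.normalized]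

theorem IsOperatorMean.smul_one_le (hσ : IsOperatorMean σ) {k : ℝ} (hk : 0 < k)
    {A B : H →L[ℂ] H} (hA : k • 1 ≤ A) (hB : k • 1 ≤ B) : k • 1 ≤ σ A B := by
  have hk1 := (isStrictlyPositive_smul_one (H := H) hk).nonneg
  rw [← hσ.smul_one_smul_one hk]
  exact hσ.monotone _ _ _ _ hk1 hk1 hA hB

theorem IsOperatorMean.le_smul_one (hσ : IsOperatorMean σ) {K : ℝ} (hK : 0 < K)
    {A B : H →L[ℂ] H} (hA0 : 0 ≤ A) (hB0 : 0 ≤ B) (hA : A ≤ K • 1) (hB : B ≤ K • 1) :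
    σ A B ≤ K • 1 := by
  rw [← hσ.smul_one_smul_one hK]
  exact hσ.monotone _ _ _ _ hA0 hB0 hA hB

theorem IsOperatorMean.isStrictlyPositive (hσ : IsOperatorMean σ) {A B : H →L[ℂ] H}
    (hA : IsStrictlyPositive A) (hB : IsStrictlyPositive B) : IsStrictlyPositive (σ A B) := by
  obtain ⟨k, hk, hkA⟩ := exists_smul_one_le hA
  obtain ⟨l, hl, hlB⟩ := exists_smul_one_le hB
  exact isStrictlyPositive_of_smul_one_le (lt_min hk hl) (hσ.smul_one_le (lt_min hk hl)
    ((smul_one_le_smul_one (min_le_left _ _)).trans hkA)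
    ((smul_one_le_smul_one (min_le_right _ _)).trans hlB))

theorem conj_eq_of_commute {P B : H →L[ℂ] H} (hP : IsStarProjection P) (h : Commute P B) :
    P * B * P = P * B := by
  rw [h.eq, mul_assoc, hP.isIdempotentElem.eq]

/-- The map `B ↦ 1 σ B` respects the projections commuting with `B`. -/
theorem IsOperatorMean.proj_mul (hσ : IsOperatorMean σ) {P B : H →L[ℂ] H}
    (hP : IsStarProjection P) (hB : 0 ≤ B) (h : Commute P B) :
    Commute P (σ 1 B) ∧ P * σ 1 B = P * σ P (P * B) * P := by
  set X := σ 1 B with hX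
  have hX0 : 0 ≤ X := hσ.nonneg _ _ zero_le_one hB
  have hPB0 : 0 ≤ P * B := by
    rw [← conj_eq_of_commute hP h]; exact hP.isSelfAdjoint.conjugate_nonneg hB
  have hPB : P * B ≤ B := by
    have := hP.one_sub.isSelfAdjoint.conjugate_nonneg hB
    rw [conj_eq_of_commute hP.one_sub ((Commute.one_left B).sub_left h), sub_mul, one_mul] at this
    exact sub_nonneg.1 this
  have h1 : P * X * P ≤ σ P (P * B) := by
    have := hσ.transformer 1 B P zero_le_one hB hP.nonneg
    rwa [mul_one, hP.isIdempotentElem.eq, conj_eq_of_commute hP h] at this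
  have hP1 : P ≤ 1 := sub_nonneg.1 hP.one_sub.nonneg
  have h2 : σ P (P * B) ≤ X := hσ.monotone _ _ _ _ hP.nonneg hPB0 hP1 hPB
  have hPXP : P * (P * X * P) * P = P * X * P := by
    rw [mul_assoc P X P, ← mul_assoc P P, hP.isIdempotentElem.eq, mul_assoc P (X * P),
      mul_assoc X, hP.isIdempotentElem.eq]
  have h3 : P * σ P (P * B) * P = P * X * P :=
    le_antisymm (hP.isSelfAdjoint.conjugate_le_conjugate h2)
      (hPXP ▸ hP.isSelfAdjoint.conjugate_le_conjugate h1)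
  -- P X P ≤ P σ (P B) ≤ X makes Z positive, and P Z P = 0 then forces Z P = 0, so X commutes with
  -- P. The compression P X P equals that of P σ (P B), which depends on P B alone: this is
  -- locality.
  set Z := X - P * X * P with hZ
  have hZ0 : 0 ≤ Z := sub_nonneg.2 (h1.trans h2)
  have hPZP : P * Z * P = 0 := by rw [hZ, mul_sub, sub_mul, hPXP, sub_self]
  have hsZ : CFC.sqrt Z * P = 0 := by
    rw [← CStarRing.star_mul_self_eq_zero_iff, star_mul, hP.isSelfAdjoint.star_eq,
      (CFC.sqrt_nonneg Z).isSelfAdjoint.star_eq, mul_assoc, ← mul_assoc (CFC.sqrt Z),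
      CFC.sqrt_mul_sqrt_self Z hZ0, ← mul_assoc, hPZP]
  have hZP : Z * P = 0 := by
    rw [← CFC.sqrt_mul_sqrt_self Z hZ0, mul_assoc, hsZ, mul_zero]
  have hXP : X * P = P * X * P := by
    rw [hZ, sub_mul, mul_assoc (P * X), hP.isIdempotentElem.eq] at hZP
    exact sub_eq_zero.1 hZP
  have hPX : P * X = P * X * P := by
    have := congr(star $hXP)
    rwa [star_mul, star_mul, star_mul, hP.isSelfAdjoint.star_eq, hX0.isSelfAdjoint.star_eq,
      ← mul_assoc] at this
  exact ⟨hPX.trans hXP.symm, hPX.trans h3.symm⟩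

theorem IsOperatorMean.isLocalMonotone (hσ : IsOperatorMean σ) :
    IsLocalMonotone (fun B => σ 1 B) where
  selfAdjoint B hB := (hσ.nonneg _ _ zero_le_one hB.nonneg).isSelfAdjoint
  mono B D hB _ h := hσ.monotone _ _ _ _ zero_le_one hB.nonneg le_rfl h
  commute B P hB hP h := (hσ.proj_mul hP hB.nonneg h).1
  locality B D P hB hD hP hPB hPD h := by
    rw [(hσ.proj_mul hP hB.nonneg hPB).2, (hσ.proj_mul hP hD.nonneg hPD).2, h]

/-- `A σ B = A^(1/2) (1 σ A^(-1/2) B A^(-1/2)) A^(1/2)`. -/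
theorem IsOperatorMean.eq_conjSqrt (hσ : IsOperatorMean σ) {A B : H →L[ℂ] H}
    (hA : IsStrictlyPositive A) (hB : 0 ≤ B) :
    σ A B = CFC.conjSqrt A (σ 1 (CFC.conjSqrt (Ring.inverse A) B)) := by
  have hD : 0 ≤ CFC.conjSqrt (Ring.inverse A) B := by
    simpa using CFC.conjSqrt_monotone (c := Ring.inverse A) hB
  have h := hσ.congruence zero_le_one hD (IsStrictlyPositive.sqrt A hA)
  rw [← CFC.conjSqrt_apply, ← CFC.conjSqrt_apply, ← CFC.conjSqrt_apply,
    CFC.conjSqrt_one A hA.nonneg, CFC.conjSqrt_conjSqrt_ringInverse A B hA] at h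
  exact h

theorem decreasesTo_add_inv_smul_one {A : H →L[ℂ] H} :
    DecreasesTo (fun k : ℕ => A + ((k : ℝ) + 1)⁻¹ • (1 : H →L[ℂ] H)) A := by
  constructor
  · intro i j hij
    refine add_le_add_right (smul_one_le_smul_one ?_) _
    gcongr
  · intro x
    have h : Tendsto (fun k : ℕ => ((k : ℝ) + 1)⁻¹) atTop (𝓝 0) := by
      simpa [one_div] using tendsto_one_div_add_atTop_nhds_zero_nat (𝕜 := ℝ)
    have h2 := (h.smul_const x).const_add (A x)
    simpa using h2

/-- An operator mean whose symbol is constant is the left trivial mean. -/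
theorem IsOperatorMean.isLeftTrivialMean (hσ : IsOperatorMean σ) {g : ℝ → ℝ}
    (hg : HasSymbol (fun B => σ 1 B) g) (hconst : ∃ c, ∀ t, 0 < t → g t = c) :
    IsLeftTrivialMean σ := by
  obtain ⟨c, hc⟩ := hconst
  have h1 : ∀ t : ℝ, 0 < t → σ 1 (t • 1) = 1 := fun t ht => by
    have e1 := hg t ht
    have e2 := hg 1 one_pos
    simp only [one_smul, hσ.normalized] at e2
    simp only at e1
    rw [e1, hc t ht, ← hc 1 one_pos, ← e2]
  have hF : ∀ B : H →L[ℂ] H, IsStrictlyPositive B → σ 1 B = 1 := fun B hB => by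
    obtain ⟨k, K, hk, hkK, hkB, hBK⟩ := exists_mem_Icc_smul_one hB
    refine le_antisymm ?_ ?_
    · exact (hσ.monotone _ _ _ _ zero_le_one hB.nonneg le_rfl hBK).trans_eq
        (h1 K (hk.trans_le hkK))
    · exact (h1 k hk).symm.trans_le
        (hσ.monotone _ _ _ _ zero_le_one (isStrictlyPositive_smul_one hk).nonneg le_rfl hkB)
  have hsp : ∀ A B : H →L[ℂ] H, IsStrictlyPositive A → IsStrictlyPositive B → σ A B = A := by
    intro A B hA hB
    rw [hσ.eq_conjSqrt hA hB.nonneg,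
      hF _ ((CFC.isStrictlyPositive_conjSqrt_iff _ _ hA.ringInverse).2 hB),
      CFC.conjSqrt_one A hA.nonneg]
  intro A B hA hB
  have hpos : ∀ {X : H →L[ℂ] H}, 0 ≤ X → ∀ k : ℕ,
      IsStrictlyPositive (X + ((k : ℝ) + 1)⁻¹ • (1 : H →L[ℂ] H)) := fun hX k =>
    IsStrictlyPositive.nonneg_add hX (isStrictlyPositive_smul_one (by positivity))
  -- The identity on invertible pairs extends to all positive pairs by letting A + 1/(k+1) and B +
  -- 1/(k+1) decrease.
  have h := (hσ.downward_continuous _ _ A B (fun k => (hpos hA k).nonneg)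
    (fun k => (hpos hB k).nonneg) hA hB decreasesTo_add_inv_smul_one
    decreasesTo_add_inv_smul_one).2
  simp only [hsp _ _ (hpos hA _) (hpos hB _)] at h
  exact ContinuousLinearMap.ext fun x =>
    tendsto_nhds_unique (h x) (decreasesTo_add_inv_smul_one.2 x)

/-- The map `B ↦ 1 σ B` has a positive, normalized and nonconstant symbol. -/
theorem IsOperatorMean.exists_symbol (hσ : IsOperatorMean σ) (hσl : ¬ IsLeftTrivialMean σ)
    (hH : 1 < Module.rank ℂ H) :
    ∃ g, HasSymbol (fun B => σ 1 B) g ∧ (∀ t, 0 < t → 0 < g t) ∧ g 1 = 1 ∧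
      ¬ ∃ c, ∀ t, 0 < t → g t = c := by
  obtain ⟨g, hg⟩ := hσ.isLocalMonotone.exists_hasSymbol
  obtain ⟨u, -, hu, -⟩ := exists_orthonormal_pair hH
  have hne : (1 : H →L[ℂ] H) ≠ 0 := fun h => by
    have := congr($h u)
    simp only [one_apply_eq_self, zero_apply] at this
    simp [this] at hu
  refine ⟨g, hg, fun t ht => ?_, ?_, fun h => hσl (hσ.isLeftTrivialMean hg h)⟩
  · have hk : 0 < min t 1 := lt_min ht one_pos
    have h := hσ.smul_one_le (A := 1) (B := t • 1) hk
      (by simpa using smul_one_le_smul_one (A := H →L[ℂ] H) (min_le_right t 1))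
      (smul_one_le_smul_one (min_le_left t 1))
    have e := hg t ht
    simp only at e
    rw [e] at h
    exact hk.trans_le (le_of_smul_le_smul_of_nonneg_of_ne_zero zero_le_one hne h)
  · have e := hg 1 one_pos
    simp only [one_smul, hσ.normalized] at e
    rw [eq_comm, ← sub_eq_zero]
    have : (1 - g 1) • (1 : H →L[ℂ] H) = 0 := by rw [sub_smul, one_smul, ← e, sub_self]
    exact (smul_eq_zero.1 this).resolve_right hne

theorem conjSqrt_smul_one_add {A : H →L[ℂ] H} (hA : IsStrictlyPositive A) (B : H →L[ℂ] H)
    (β α : ℝ) :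
    CFC.conjSqrt A (β • (1 : H →L[ℂ] H) + α • CFC.conjSqrt (Ring.inverse A) B)
      = β • A + α • B := by
  rw [map_add, map_smul, map_smul, CFC.conjSqrt_one A hA.nonneg,
    CFC.conjSqrt_conjSqrt_ringInverse A B hA]

theorem IsOperatorMean.exists_le_arith (hσ : IsOperatorMean σ) (hσl : ¬ IsLeftTrivialMean σ)
    (hH : 1 < Module.rank ℂ H) :
    ∃ α : ℝ, 0 < α ∧ ∀ A B : H →L[ℂ] H, IsStrictlyPositive A → IsStrictlyPositive B →
      σ A B ≤ (1 - α) • A + α • B := by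
  obtain ⟨g, hg, hg0, hg1, hconst⟩ := hσ.exists_symbol hσl hH
  obtain ⟨α, hα, h⟩ := hσ.isLocalMonotone.exists_le_affine hH hg (fun t ht => (hg0 t ht).le) hg1
    hconst
  refine ⟨α, hα, fun A B hA hB => ?_⟩
  rw [hσ.eq_conjSqrt hA hB.nonneg, ← conjSqrt_smul_one_add hA B]
  exact CFC.conjSqrt_monotone
    (h _ ((CFC.isStrictlyPositive_conjSqrt_iff _ _ hA.ringInverse).2 hB))

/-- The adjoint map B ↦ (1 σ B⁻¹)⁻¹ is again local monotone with a normalized nonconstant symbol, so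
it too has an affine majorant. -/
theorem IsOperatorMean.exists_inv_le_arith_inv (hσ : IsOperatorMean σ)
    (hσl : ¬ IsLeftTrivialMean σ) (hH : 1 < Module.rank ℂ H) :
    ∃ α : ℝ, 0 < α ∧ ∀ A B : H →L[ℂ] H, IsStrictlyPositive A → IsStrictlyPositive B →
      Ring.inverse (σ A B) ≤ (1 - α) • Ring.inverse A + α • Ring.inverse B := by
  obtain ⟨g, hg, hg0, hg1, hconst⟩ := hσ.exists_symbol hσl hH
  have hpos : ∀ B, IsStrictlyPositive B → IsStrictlyPositive (σ 1 B) := fun B hB =>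
    hσ.isStrictlyPositive isStrictlyPositive_one hB
  obtain ⟨α, hα, h⟩ := (hσ.isLocalMonotone.adjoint hpos).exists_le_affine hH (hg.adjoint hg0)
    (fun t ht => (inv_pos.2 (hg0 _ (inv_pos.2 ht))).le) (by simp [hg1]) (by
      rintro ⟨c, hc⟩
      refine hconst ⟨c⁻¹, fun t ht => ?_⟩
      have := hc t⁻¹ (inv_pos.2 ht)
      rw [inv_inv] at this
      rw [← this, inv_inv])
  refine ⟨α, hα, fun A B hA hB => ?_⟩
  have hD : IsStrictlyPositive (CFC.conjSqrt (Ring.inverse A) B) :=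
    (CFC.isStrictlyPositive_conjSqrt_iff _ _ hA.ringInverse).2 hB
  rw [hσ.eq_conjSqrt hA hB.nonneg, CFC.ringInverse_conjSqrt A _ hA,
    ← conjSqrt_smul_one_add hA.ringInverse (Ring.inverse B),
    ← CFC.ringInverse_conjSqrt (Ring.inverse A) B hA.ringInverse]
  refine CFC.conjSqrt_monotone ?_
  have := h _ hD.ringInverse
  rwa [Ring.inverse_inverse hD.isUnit] at this

/-- With c = 1/(1 + a), homogeneity gives X σ B ≤ (1 + a) (Y σ cB). The operator Y^(-1/2) B Y^(-1/2)
lies in [k/K, K/k], where the symbol loses a factor 1 - θ (1 - c); the product (1 + a)(1 - θ (1 -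
c)) is 1 + (1 - θ) a. -/
theorem IsOperatorMean.exists_contraction (hσ : IsOperatorMean σ) (hσl : ¬ IsLeftTrivialMean σ)
    (hH : 1 < Module.rank ℂ H) {k K : ℝ} (hk : 0 < k) (hkK : k ≤ K) :
    ∃ ρ : ℝ, 0 ≤ ρ ∧ ρ < 1 ∧ ∀ X Y B : H →L[ℂ] H, X ∈ Set.Icc (k • 1) (K • 1) →
      Y ∈ Set.Icc (k • 1) (K • 1) → B ∈ Set.Icc (k • 1) (K • 1) →
      ∀ a : ℝ, 0 ≤ a → X ≤ (1 + a) • Y → σ X B ≤ (1 + ρ * a) • σ Y B := by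
  have hK : 0 < K := hk.trans_le hkK
  obtain ⟨g, hg, hg0, hg1, hconst⟩ := hσ.exists_symbol hσl hH
  obtain ⟨θ, hθ0, hθ1, h⟩ := hσ.isLocalMonotone.exists_contraction hH hg hg0 hconst
    ((one_le_div hk).2 hkK)
  refine ⟨1 - θ, by linarith, by linarith, fun X Y B hX hY hB a ha hXY => ?_⟩
  have hXp := isStrictlyPositive_of_smul_one_le hk hX.1
  have hYp := isStrictlyPositive_of_smul_one_le hk hY.1
  have hBp := isStrictlyPositive_of_smul_one_le hk hB.1
  have ha1 : 0 < 1 + a := by linarith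
  set c := (1 + a)⁻¹ with hc
  have hc0 : 0 < c := inv_pos.2 ha1
  have hc1 : c ≤ 1 := inv_le_one_of_one_le₀ (by linarith)
  have hac : (1 + a) * c = 1 := mul_inv_cancel₀ ha1.ne'
  set D := CFC.conjSqrt (Ring.inverse Y) B with hD
  have hYi1 : K⁻¹ • 1 ≤ Ring.inverse Y := by
    rw [← ringInverse_smul_one hK.ne']
    exact CStarAlgebra.ringInverse_le_ringInverse hY.2 hYp
  have hYi2 : Ring.inverse Y ≤ k⁻¹ • 1 := by
    rw [← ringInverse_smul_one hk.ne']
    exact CStarAlgebra.ringInverse_le_ringInverse hY.1 (isStrictlyPositive_smul_one hk)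
  have hD1 : (K / k)⁻¹ • 1 ≤ D := by
    have h1 := CFC.conjSqrt_monotone (c := Ring.inverse Y) hB.1
    rw [map_smul, CFC.conjSqrt_one _ hYp.ringInverse.nonneg] at h1
    have h2 := smul_le_smul_of_nonneg_left hYi1 hk.le
    rw [smul_smul, ← div_eq_mul_inv] at h2
    rw [inv_div]
    exact h2.trans h1
  have hD2 : D ≤ (K / k) • 1 := by
    have h1 := CFC.conjSqrt_monotone (c := Ring.inverse Y) hB.2
    rw [map_smul, CFC.conjSqrt_one _ hYp.ringInverse.nonneg] at h1
    have h2 := smul_le_smul_of_nonneg_left hYi2 hK.le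
    rw [smul_smul, ← div_eq_mul_inv] at h2
    exact h1.trans h2
  have key := CFC.conjSqrt_monotone (c := Y) (h D hD1 hD2 c hc0 hc1)
  simp only [hD] at key
  rw [← map_smul, map_smul (CFC.conjSqrt Y), ← hσ.eq_conjSqrt hYp hBp.nonneg,
    ← hσ.eq_conjSqrt hYp (hBp.smul hc0).nonneg] at key
  calc σ X B ≤ σ ((1 + a) • Y) ((1 + a) • c • B) := by
        rw [smul_smul, hac, one_smul]
        exact hσ.monotone _ _ _ _ hXp.nonneg hBp.nonneg hXY le_rfl
    _ = (1 + a) • σ Y (c • B) := hσ.map_smul_smul hYp.nonneg (hBp.smul hc0).nonneg ha1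
    _ ≤ (1 + a) • (1 - θ * (1 - c)) • σ Y B := smul_le_smul_of_nonneg_left key ha1.le
    _ = (1 + (1 - θ) * a) • σ Y B := by
        rw [smul_smul]
        congr 1
        linear_combination θ * hac

end OperatorMean

/-! ### The deformed mean: existence, uniqueness and the sandwich -/

section DeformedMean

variable {H : Type*} [NormedAddCommGroup H] [InnerProductSpace ℂ H] [CompleteSpace H]
  {σ : (H →L[ℂ] H) → (H →L[ℂ] H) → (H →L[ℂ] H)} {n : ℕ}
  {𝔐 : (Fin n → H →L[ℂ] H) → (H →L[ℂ] H)}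

theorem IsMultiOperatorMean.map_smul (h𝔐 : IsMultiOperatorMean 𝔐) {A : Fin n → H →L[ℂ] H}
    (hA : ∀ j, IsStrictlyPositive (A j)) {c : ℝ} (hc : 0 < c) :
    𝔐 (fun j => c • A j) = c • 𝔐 A := by
  have hS := isStrictlyPositive_smul_one (H := H) (Real.sqrt_pos.2 hc)
  have := h𝔐.congruence A _ hA hS.isUnit
  simpa only [hS.isSelfAdjoint.star_eq, sqrt_smul_one_conj hc] using this.symm

theorem exists_common_bounds {B : Fin n → H →L[ℂ] H} (hB : ∀ j, IsStrictlyPositive (B j)) :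
    ∃ k K : ℝ, 0 < k ∧ k ≤ K ∧ ∀ j, B j ∈ Set.Icc (k • 1) (K • 1) := by
  choose k hk hkB using fun j => exists_smul_one_le (hB j)
  obtain ⟨k₀, hk₀, hk₀k⟩ : ∃ k₀ : ℝ, 0 < k₀ ∧ ∀ j, k₀ ≤ k j := by
    rcases isEmpty_or_nonempty (Fin n) with h | h
    · exact ⟨1, one_pos, fun j => h.elim j⟩
    · obtain ⟨i, hi⟩ := Finite.exists_min k
      exact ⟨k i, hk i, hi⟩
  refine ⟨k₀, max k₀ (∑ j, ‖B j‖), hk₀, le_max_left _ _, fun j =>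
    ⟨(smul_one_le_smul_one (hk₀k j)).trans (hkB j), ?_⟩⟩
  exact (le_norm_smul_one (hB j).isSelfAdjoint).trans (smul_one_le_smul_one
    ((Finset.single_le_sum (f := fun j => ‖B j‖) (fun _ _ => norm_nonneg _)
      (Finset.mem_univ j)).trans (le_max_right _ _)))

/-- 𝔐 is monotone and homogeneous, so it carries the contraction of each X ↦ X σ B_j over to X ↦ 𝔐(X
σ B_j). The rate ρ depends on the order interval: for existence one containing the B_j suffices, for
uniqueness it is enlarged to contain both solutions. -/
theorem existsUnique_solvesDeformedEq (hH : 1 < Module.rank ℂ H) (h𝔐 : IsMultiOperatorMean 𝔐)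
    (hσ : IsOperatorMean σ) (hσl : ¬ IsLeftTrivialMean σ) {B : Fin n → H →L[ℂ] H}
    (hB : ∀ j, IsStrictlyPositive (B j)) : ∃! X : H →L[ℂ] H, SolvesDeformedEq 𝔐 σ B X := by
  have contr : ∀ k K : ℝ, 0 < k → k ≤ K → (∀ j, B j ∈ Set.Icc (k • 1) (K • 1)) →
      ∃ ρ : ℝ, 0 ≤ ρ ∧ ρ < 1 ∧ ∀ X Y : H →L[ℂ] H, X ∈ Set.Icc (k • 1) (K • 1) →
      Y ∈ Set.Icc (k • 1) (K • 1) → ∀ a : ℝ, 0 ≤ a → X ≤ (1 + a) • Y →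
      𝔐 (fun j => σ X (B j)) ≤ (1 + ρ * a) • 𝔐 (fun j => σ Y (B j)) := by
    intro k K hk hkK hBk
    obtain ⟨ρ, h0, h1, h⟩ := hσ.exists_contraction hσl hH hk hkK
    refine ⟨ρ, h0, h1, fun X Y hX hY a ha hXY => ?_⟩
    have hX' := isStrictlyPositive_of_smul_one_le hk hX.1
    have hY' := isStrictlyPositive_of_smul_one_le hk hY.1
    have hc : 0 < 1 + ρ * a := by positivity
    rw [← h𝔐.map_smul (fun j => hσ.isStrictlyPositive hY' (hB j)) hc]
    exact h𝔐.monotone _ _ (fun j => hσ.isStrictlyPositive hX' (hB j))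
      (fun j => (hσ.isStrictlyPositive hY' (hB j)).smul hc)
      fun j => h X Y (B j) hX hY (hBk j) a ha hXY
  have huniq : ∀ X Y : H →L[ℂ] H, SolvesDeformedEq 𝔐 σ B X → SolvesDeformedEq 𝔐 σ B Y →
      X ≤ Y := by
    intro X Y hX hY
    obtain ⟨k₁, K₁, hk₁, hkK₁, hkX, hXK⟩ := exists_mem_Icc_smul_one hX.1
    obtain ⟨k₂, K₂, hk₂, hkK₂, hkY, hYK⟩ := exists_mem_Icc_smul_one hY.1
    obtain ⟨k₃, K₃, hk₃, hkK₃, hBk⟩ := exists_common_bounds hB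
    have hk : 0 < min (min k₁ k₂) k₃ := lt_min (lt_min hk₁ hk₂) hk₃
    have hkK : min (min k₁ k₂) k₃ ≤ max (max K₁ K₂) K₃ :=
      (min_le_right _ _).trans (hkK₃.trans (le_max_right _ _))
    obtain ⟨ρ, h0, h1, h⟩ := contr _ _ hk hkK fun j =>
      ⟨(smul_one_le_smul_one (min_le_right _ _)).trans (hBk j).1,
        (hBk j).2.trans (smul_one_le_smul_one (le_max_right _ _))⟩
    refine fixedPoint_le_of_contraction (Φ := fun X => 𝔐 (fun j => σ X (B j))) hk hkK h0 h1 h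
      ⟨(smul_one_le_smul_one ?_).trans hkX, hXK.trans (smul_one_le_smul_one ?_)⟩
      ⟨(smul_one_le_smul_one ?_).trans hkY, hYK.trans (smul_one_le_smul_one ?_)⟩
      hX.2.symm hY.2.symm
    · exact (min_le_left _ _).trans (min_le_left _ _)
    · exact (le_max_left _ _).trans (le_max_left _ _)
    · exact (min_le_left _ _).trans (min_le_right _ _)
    · exact (le_max_right _ _).trans (le_max_left _ _)
  obtain ⟨k, K, hk, hkK, hBk⟩ := exists_common_bounds hB
  have hK : 0 < K := hk.trans_le hkK
  obtain ⟨ρ, h0, h1, h⟩ := contr k K hk hkK hBk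
  have hscal : ∀ c : ℝ, 0 < c → 𝔐 (fun _ => c • 1) = c • 1 := fun c hc => by
    rw [h𝔐.map_smul (A := fun _ => 1) (fun _ => isStrictlyPositive_one) hc, h𝔐.normalized]
  obtain ⟨X, hXmem, hX⟩ := exists_fixedPoint_of_contraction
    (Φ := fun X => 𝔐 (fun j => σ X (B j))) hk hkK h0 h1 (fun X hX => by
      have hX' := isStrictlyPositive_of_smul_one_le hk hX.1
      have hs := fun j => hσ.isStrictlyPositive hX' (hB j)
      constructor
      · rw [← hscal k hk]
        exact h𝔐.monotone _ _ (fun _ => isStrictlyPositive_smul_one hk) hs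
          fun j => hσ.smul_one_le hk hX.1 (hBk j).1
      · rw [← hscal K hK]
        exact h𝔐.monotone _ _ hs (fun _ => isStrictlyPositive_smul_one hK)
          fun j => hσ.le_smul_one hK hX'.nonneg (hB j).nonneg hX.2 (hBk j).2) h
  have hXs : SolvesDeformedEq 𝔐 σ B X := ⟨isStrictlyPositive_of_smul_one_le hk hXmem.1, hX.symm⟩
  exact ⟨X, hXs, fun Y hY => le_antisymm (huniq Y X hY hXs) (huniq X Y hXs hY)⟩

variable {ω : Fin n → ℝ}

theorem sum_smul_add_smul (hω1 : ∑ j, ω j = 1) (X : H →L[ℂ] H) (B : Fin n → H →L[ℂ] H) (α : ℝ) :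
    ∑ j, ω j • ((1 - α) • X + α • B j) = (1 - α) • X + α • ∑ j, ω j • B j := by
  simp_rw [smul_add, Finset.sum_add_distrib, ← Finset.sum_smul, hω1, one_smul, Finset.smul_sum,
    smul_comm α]

theorem le_of_le_one_sub_smul_add {X Y : H →L[ℂ] H} {α : ℝ} (hα : 0 < α)
    (h : X ≤ (1 - α) • X + α • Y) : X ≤ Y := by
  have h1 : α • X ≤ α • Y := by
    rw [← sub_nonneg] at h ⊢
    convert h using 1
    rw [sub_smul, one_smul]
    abel
  have h2 := smul_le_smul_of_nonneg_left h1 (inv_nonneg.2 hα.le)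
  rwa [smul_smul, smul_smul, inv_mul_cancel₀ hα.ne', one_smul, one_smul] at h2

/-- From X = 𝔐(X σ B_j) ≤ ∑ ω_j (X σ B_j) ≤ (1 - α) X + α ∑ ω_j B_j the common part of X cancels, as
α > 0. -/
theorem SolvesDeformedEq.le_arithMean (hH : 1 < Module.rank ℂ H) (hω : ∀ j, 0 ≤ ω j)
    (hω1 : ∑ j, ω j = 1)
    (h𝔐ω : ∀ B : Fin n → H →L[ℂ] H, (∀ j, IsStrictlyPositive (B j)) → 𝔐 B ≤ arithMean ω B)
    (hσ : IsOperatorMean σ) (hσl : ¬ IsLeftTrivialMean σ) {B : Fin n → H →L[ℂ] H}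
    (hB : ∀ j, IsStrictlyPositive (B j)) {X : H →L[ℂ] H} (hX : SolvesDeformedEq 𝔐 σ B X) :
    X ≤ ∑ j, ω j • B j := by
  obtain ⟨α, hα, h⟩ := hσ.exists_le_arith hσl hH
  refine le_of_le_one_sub_smul_add hα ?_
  rw [← sum_smul_add_smul hω1]
  conv_lhs => rw [hX.2]
  exact (h𝔐ω _ fun j => hσ.isStrictlyPositive hX.1 (hB j)).trans
    (Finset.sum_le_sum fun j _ => smul_le_smul_of_nonneg_left (h X (B j) hX.1 (hB j)) (hω j))

theorem isStrictlyPositive_sum_smul (hω : ∀ j, 0 ≤ ω j) (hω1 : ∑ j, ω j = 1)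
    {B : Fin n → H →L[ℂ] H} (hB : ∀ j, IsStrictlyPositive (B j)) :
    IsStrictlyPositive (∑ j, ω j • B j) := by
  obtain ⟨k, K, hk, -, hBk⟩ := exists_common_bounds hB
  exact isStrictlyPositive_of_smul_one_le hk (smul_one_le_sum hω hω1 fun j => (hBk j).1)

/-- The same cancellation for X⁻¹, fed by the affine bound on (X σ B_j)⁻¹, followed by inversion. -/
theorem SolvesDeformedEq.harmMean_le (hH : 1 < Module.rank ℂ H) (hω : ∀ j, 0 ≤ ω j)
    (hω1 : ∑ j, ω j = 1)
    (h𝔐ω : ∀ B : Fin n → H →L[ℂ] H, (∀ j, IsStrictlyPositive (B j)) → harmMean ω B ≤ 𝔐 B)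
    (hσ : IsOperatorMean σ) (hσl : ¬ IsLeftTrivialMean σ) {B : Fin n → H →L[ℂ] H}
    (hB : ∀ j, IsStrictlyPositive (B j)) {X : H →L[ℂ] H} (hX : SolvesDeformedEq 𝔐 σ B X) :
    Ring.inverse (∑ j, ω j • Ring.inverse (B j)) ≤ X := by
  obtain ⟨α, hα, h⟩ := hσ.exists_inv_le_arith_inv hσl hH
  have hs := fun j => hσ.isStrictlyPositive hX.1 (hB j)
  have hS := isStrictlyPositive_sum_smul hω hω1 fun j => (hs j).ringInverse
  have h1 : Ring.inverse (∑ j, ω j • Ring.inverse (σ X (B j))) ≤ X := by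
    conv_rhs => rw [hX.2]
    exact h𝔐ω _ hs
  have h2 := CStarAlgebra.ringInverse_le_ringInverse h1 hS.ringInverse
  rw [Ring.inverse_inverse hS.isUnit] at h2
  have h3 : Ring.inverse X ≤ ∑ j, ω j • Ring.inverse (B j) := by
    refine le_of_le_one_sub_smul_add hα ?_
    rw [← sum_smul_add_smul hω1]
    exact h2.trans (Finset.sum_le_sum fun j _ =>
      smul_le_smul_of_nonneg_left (h X (B j) hX.1 (hB j)) (hω j))
  have h4 := CStarAlgebra.ringInverse_le_ringInverse h3 hX.1.ringInverse
  rwa [Ring.inverse_inverse hX.1.isUnit] at h4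

theorem solvesDeformedEq_deformedMean {B : Fin n → H →L[ℂ] H}
    (h : ∃! X : H →L[ℂ] H, SolvesDeformedEq 𝔐 σ B X) :
    SolvesDeformedEq 𝔐 σ B (deformedMean 𝔐 σ B) := by
  rw [deformedMean, dif_pos h]
  exact h.choose_spec.1

theorem deformedMean_rpow_mem_Icc (hH : 1 < Module.rank ℂ H) (hω : ∀ j, 0 ≤ ω j)
    (hω1 : ∑ j, ω j = 1) (h𝔐 : IsMultiOperatorMean 𝔐)
    (h𝔐ω : ∀ B : Fin n → H →L[ℂ] H, (∀ j, IsStrictlyPositive (B j)) →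
      harmMean ω B ≤ 𝔐 B ∧ 𝔐 B ≤ arithMean ω B)
    (hσ : IsOperatorMean σ) (hσl : ¬ IsLeftTrivialMean σ) {A : Fin n → H →L[ℂ] H}
    (hA : ∀ j, IsStrictlyPositive (A j)) {p : ℝ} (hp : p ≠ 0) :
    (∑ j, ω j • A j ^ (-p)) ^ (-1 : ℝ) ≤ deformedMean 𝔐 σ (fun j => A j ^ p) ∧
      deformedMean 𝔐 σ (fun j => A j ^ p) ≤ ∑ j, ω j • A j ^ p := by
  have hAp := fun j => (hA j).rpow _ p
  have hX := solvesDeformedEq_deformedMean (existsUnique_solvesDeformedEq hH h𝔐 hσ hσl hAp)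
  refine ⟨?_, hX.le_arithMean hH hω hω1 (fun B hB => (h𝔐ω B hB).2) hσ hσl hAp⟩
  have h := hX.harmMean_le hH hω hω1 (fun B hB => (h𝔐ω B hB).1) hσ hσl hAp
  have e : ∀ j, Ring.inverse (A j ^ p) = A j ^ (-p) := fun j => by
    rw [CFC.inverse_eq_rpow_neg_one (hAp j), CFC.rpow_rpow _ _ _ hp (hA j), mul_neg_one]
  simp only [e] at h
  rwa [CFC.inverse_eq_rpow_neg_one
    (isStrictlyPositive_sum_smul hω hω1 fun j => (hA j).rpow _ (-p))] at h

end DeformedMean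

/-! ### Main theorem -/

theorem theorem4p1 {H : Type*} [NormedAddCommGroup H] [InnerProductSpace ℂ H] [CompleteSpace H]
    (hH : 1 < Module.rank ℂ H) {n : ℕ} (ω : Fin n → ℝ) (hω : ∀ j, 0 ≤ ω j) (hω1 : ∑ j, ω j = 1)
    (𝔐 : (Fin n → H →L[ℂ] H) → (H →L[ℂ] H)) (h𝔐 : IsMultiOperatorMean 𝔐)
    (h𝔐ω : ∀ B : Fin n → H →L[ℂ] H, (∀ j, IsStrictlyPositive (B j)) →
      harmMean ω B ≤ 𝔐 B ∧ 𝔐 B ≤ arithMean ω B)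
    (σ : (H →L[ℂ] H) → (H →L[ℂ] H) → (H →L[ℂ] H)) (hσ : IsOperatorMean σ)
    (hσl : ¬ IsLeftTrivialMean σ)
    (A : Fin n → H →L[ℂ] H) (m M h : ℝ) (hm : 0 < m) (hmM : m < M) (hh : h = M / m)
    (hA : ∀ j, m • (1 : H →L[ℂ] H) ≤ A j ∧ A j ≤ M • (1 : H →L[ℂ] H)) :
    -- the deformed mean is well defined
    (∀ B : Fin n → H →L[ℂ] H, (∀ j, IsStrictlyPositive (B j)) →
      ∃! X : H →L[ℂ] H, SolvesDeformedEq 𝔐 σ B X) ∧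
    (∀ p q : ℝ, 1 ≤ q → q ≤ p →
      kantorovich (h ^ p) (-(q / p)) ^ (-(1 / q)) •
          deformedMean 𝔐 σ (fun j => A j ^ p) ^ (1 / p)
        ≤ deformedMean 𝔐 σ (fun j => A j ^ q) ^ (1 / q) ∧
      deformedMean 𝔐 σ (fun j => A j ^ q) ^ (1 / q)
        ≤ kantorovich (h ^ p) (-(q / p)) ^ (1 / q) •
          deformedMean 𝔐 σ (fun j => A j ^ p) ^ (1 / p)) ∧
    (∀ p q : ℝ, 0 < q → q < 1 → q < p →
      ((kantorovich (h ^ q) (1 / q))⁻¹ * kantorovich (h ^ p) (-(q / p)) ^ (-(1 / q))) •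
          deformedMean 𝔐 σ (fun j => A j ^ p) ^ (1 / p)
        ≤ deformedMean 𝔐 σ (fun j => A j ^ q) ^ (1 / q) ∧
      deformedMean 𝔐 σ (fun j => A j ^ q) ^ (1 / q)
        ≤ (kantorovich (h ^ q) (1 / q) * kantorovich (h ^ p) (-(q / p)) ^ (1 / q)) •
          deformedMean 𝔐 σ (fun j => A j ^ p) ^ (1 / p)) ∧
    (∀ p : ℝ, 0 < p →
      ((specht h)⁻¹ * specht (h ^ p) ^ (-(1 / p))) •
          deformedMean 𝔐 σ (fun j => A j ^ p) ^ (1 / p)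
        ≤ NormedSpace.exp (∑ j, ω j • CFC.log (A j)) ∧
      NormedSpace.exp (∑ j, ω j • CFC.log (A j))
        ≤ (specht h * specht (h ^ p) ^ (1 / p)) •
          deformedMean 𝔐 σ (fun j => A j ^ p) ^ (1 / p)) := by
  have hsp := fun j => isStrictlyPositive_of_smul_one_le hm (hA j).1
  have h1 := fun j => (hA j).1
  have h2 := fun j => (hA j).2
  have hX : ∀ p : ℝ, 0 < p → _ := fun p hp =>
    deformedMean_rpow_mem_Icc (p := p) hH hω hω1 h𝔐 h𝔐ω hσ hσl hsp hp.ne'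
  subst hh
  refine ⟨fun B hB => existsUnique_solvesDeformedEq hH h𝔐 hσ hσl hB, fun p q hq hqp => ?_,
    fun p q hq0 hq hqp => ?_, fun p hp => ?_⟩
  · obtain ⟨hX1, hX2⟩ := hX p (by linarith)
    obtain ⟨hY1, hY2⟩ := hX q (by linarith)
    exact kantorovich_bounds_of_one_le hω hω1 hm hmM h1 h2 hX1 hX2 hY1 hY2 hq hqp
  · obtain ⟨hX1, hX2⟩ := hX p (by linarith)
    obtain ⟨hY1, hY2⟩ := hX q hq0
    exact kantorovich_bounds_of_lt_one hω hω1 hm hmM h1 h2 hX1 hX2 hY1 hY2 hq0 hq hqp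
  · obtain ⟨hX1, hX2⟩ := hX p hp
    exact specht_bounds hω hω1 hm hmM h1 h2 hX1 hX2 hp
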